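/- All systems are finite-dimensional, $\beta\in\mathbb{R}$ is a fixed inverse temperature, and logarithms are natural. \textbf{Definitions.} A system $X$ with Hamiltonian $H_X$ has the Gibbs state $\gamma_X = e^{-\beta H_X}/\operatorname{tr} e^{-\beta H_X}$; different systems do not interact, so Hamiltonians add. A thermal operation on $X$ is a map $\Phi(\cdot)=\operatorname{tr}_B[U((\cdot)\otimes\gamma_B)U^\dagger]$, where $B$ is a system with some Hamiltonian $H_B$ and $U$ is a unitary on $X\otimes B$ with $[U,H_X+H_B]=0$. An information battery is a system $J$ of some dimension $d$ with $H_J=0$. Its battery states are $\tau=P/\operatorname{tr}P$ for nonzero orthogonal projectors $P$, with charge $w(\tau)=\ln d-\ln\operatorname{rank}P$ (in pure nats). The effective work process of a map $\Phi_{XJ\to XJ}$ with respect to battery states $(\tau,\tau')$ is $\mathcal{T}_{X\to X}(\cdot)=\operatorname{tr}_J[(1\otimes P')\,\Phi((\cdot)\otimes\tau)]$, where $P'$ is the projector of $\tau'$. The fidelity is $F(\rho,\sigma)=\|\sqrt\rho\sqrt\sigma\|_1$. For $0<\eta\le1$, a state $\rho$ and a positive semidefinite $\sigma$ whose support contains that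 of $\rho$, the hypothesis testing relative entropy $D_h^\eta(\rho\|\sigma)$ is given by $$\exp[-D_h^{\eta}(\rho\|\sigma)]=\min\{\operatorname{tr}[Q\sigma] : 0\le Q\le 1,\ \operatorname{tr}[Q\rho]\ge\eta\}.$$ \textbf{Corollary.} Let $S,M,R$ be quantum systems, with $H_S$ and $H_M$ the Hamiltonians of $S$ and $M$. Let $|\rho\rangle_{SMR}$ be any pure state such that $[\rho_{SM},H_S+H_M]=0$. Let $0<\epsilon<1$, and suppose that $D_h^{1-\epsilon}(\rho_{SM}\|\gamma_S\otimes\rho_M)\ge\ln(2/\epsilon)$. Then there exist an information battery $J$ with battery states $\tau_J,\tau_J'$ and a thermal operation $\mathcal{R}_{SMJ\to SMJ}$ on $SMJ$ such that: (i) the effective work process $\mathcal{T}_{SM\to SM}$ associated with $\mathcal{R}_{SMJ\to SMJ}$ and $(\tau_J,\tau_J')$ satisfies $$F\big(\mathcal{T}_{SM\to SM}(\rho_{SMR}),\ \gamma_S\otimes\rho_{MR}\big)\ge 1-6\epsilon ,$$ where $\mathcal{T}_{SM\to SM}$ acts as the identity on $R$; (ii) the associated work cost (in units of pure nats) satisfies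 $$w(\tau_J)-w(\tau_J')\le -D_h^{1-\epsilon}(\rho_{SM}\|\gamma_S\otimes\rho_M)+\ln(2/\epsilon).$$ -/

import Mathlib

open Matrix
open scoped Kronecker ComplexOrder MatrixOrder

namespace ThermalErasure

/-! Finite-dimensional quantum systems are represented by finite index types (their standard
bases); operators on a system `X` are the matrices `Matrix X X ℂ`, and the composite of `X` and
`Y` has index type `X × Y`. -/

noncomputable section

/-- Partial trace over the second tensor factor. -/
def trRight {X Y : Type*} [Fintype Y] (A : Matrix (X × Y) (X × Y) ℂ) : Matrix X X ℂ :=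
  Matrix.of fun x x' => ∑ y, A (x, y) (x', y)

/-- Partial trace over the first tensor factor. -/
def trLeft {X Y : Type*} [Fintype X] (A : Matrix (X × Y) (X × Y) ℂ) : Matrix Y Y ℂ :=
  Matrix.of fun y y' => ∑ x, A (x, y) (x, y')

/-- The projector `|ψ⟩⟨ψ|` onto a (unit) vector `ψ`. -/
def pureState {X : Type*} (ψ : X → ℂ) : Matrix X X ℂ :=
  vecMulVec ψ (star ψ)

/-- The map `T ⊗ id_R` applied to an operator on `X ⊗ R`. -/
def applyLeft {X X' : Type*} (R : Type*) (T : Matrix X X ℂ →ₗ[ℂ] Matrix X' X' ℂ)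
    (A : Matrix (X × R) (X × R) ℂ) : Matrix (X' × R) (X' × R) ℂ :=
  Matrix.of fun i j => T (Matrix.of fun x x' => A (x, i.2) (x', j.2)) i.1 j.1

/-- The trace norm `‖A‖₁ = tr √(A† A)`. -/
def traceNorm {X : Type*} [Fintype X] [DecidableEq X] (A : Matrix X X ℂ) : ℝ :=
  (CFC.sqrt (Aᴴ * A)).trace.re

/-- The (root) fidelity `F(ρ, σ) = ‖√ρ √σ‖₁` of positive semidefinite operators. -/
def fidelity {X : Type*} [Fintype X] [DecidableEq X] (ρ σ : Matrix X X ℂ) : ℝ :=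
  traceNorm (CFC.sqrt ρ * CFC.sqrt σ)

/-- `D_H^η(ρ‖σ)`, where `exp (-D_H^η(ρ‖σ))` is the minimum of `η⁻¹ tr[Q σ]` over all
`0 ≤ Q ≤ 1` with `tr[Q ρ] ≥ η`. It is meant for `0 < η ≤ 1`, `ρ` a state and `σ` positive
semidefinite with the support of `ρ` inside that of `σ`; then the minimum is positive. -/
def DHypNormalized {X : Type*} [Fintype X] [DecidableEq X] (η : ℝ) (ρ σ : Matrix X X ℂ) : ℝ :=
  -Real.log (sInf {t : ℝ | ∃ Q : Matrix X X ℂ, Q.PosSemidef ∧ (1 - Q).PosSemidef ∧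
    η ≤ (Q * ρ).trace.re ∧ t = η⁻¹ * (Q * σ).trace.re})

/-- The hypothesis testing relative entropy `D_h^η(ρ‖σ) = D_H^η(ρ‖σ) - ln η`, so that
`exp (-D_h^η(ρ‖σ))` is the minimum of `tr[Q σ]` over the same set of `Q`. -/
def DHyp {X : Type*} [Fintype X] [DecidableEq X] (η : ℝ) (ρ σ : Matrix X X ℂ) : ℝ :=
  DHypNormalized η ρ σ - Real.log η

/-- The Gibbs state `e^{-β H} / tr e^{-β H}`. -/
def gibbs {X : Type*} [Fintype X] [DecidableEq X] (β : ℝ) (H : Matrix X X ℂ) : Matrix X X ℂ :=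
  (NormedSpace.exp ((-β : ℂ) • H)).trace⁻¹ • NormedSpace.exp ((-β : ℂ) • H)

/-- The Hamiltonian `H_X + H_Y` of two noninteracting systems. -/
def totalHam {X Y : Type*} [DecidableEq X] [DecidableEq Y]
    (HX : Matrix X X ℂ) (HY : Matrix Y Y ℂ) : Matrix (X × Y) (X × Y) ℂ :=
  HX ⊗ₖ (1 : Matrix Y Y ℂ) + (1 : Matrix X X ℂ) ⊗ₖ HY

/-- `Φ` is a thermal operation on the system `X` with Hamiltonian `H`, at inverse temperature
`β`: there are a (nonzero, finite-dimensional) bath `B` with a Hamiltonian `H_B` and a unitary `U`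
commuting with `H + H_B` such that `Φ(·) = tr_B[U (· ⊗ γ_B) U†]`. -/
def IsThermalOperation {X : Type*} [Fintype X] [DecidableEq X] (β : ℝ) (H : Matrix X X ℂ)
    (Φ : Matrix X X ℂ →ₗ[ℂ] Matrix X X ℂ) : Prop :=
  ∃ b : ℕ, 0 < b ∧ ∃ HB : Matrix (Fin b) (Fin b) ℂ, HB.IsHermitian ∧
    ∃ U ∈ Matrix.unitaryGroup (X × Fin b) ℂ, Commute U (totalHam H HB) ∧
      ∀ A : Matrix X X ℂ, Φ A = trRight (U * (A ⊗ₖ gibbs β HB) * Uᴴ)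

/-- A state of an information battery with register `W`: it is given by a nonzero orthogonal
projector `P`, the state being `P / tr P`. The Hamiltonian of an information battery is zero. -/
structure BatteryState (W : Type*) [Fintype W] [DecidableEq W] where
  /-- The projector `P`. -/
  proj : Matrix W W ℂ
  isStarProjection : IsStarProjection proj
  proj_ne_zero : proj ≠ 0

/-- The density operator `τ = P / tr P` of a battery state. -/
def BatteryState.state {W : Type*} [Fintype W] [DecidableEq W] (τ : BatteryState W) :
    Matrix W W ℂ :=
  τ.proj.trace⁻¹ • τ.proj

/-- The charge `w(τ) = ln d - m` in pure nats, `d` being the dimension of the battery and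
`e^m` the rank of `P`. -/
def BatteryState.charge {W : Type*} [Fintype W] [DecidableEq W] (τ : BatteryState W) : ℝ :=
  Real.log (Fintype.card W) - Real.log τ.proj.rank

/-- The effective work process `A ↦ tr_W[(1 ⊗ P') Φ(A ⊗ τ)]` of `Φ` with respect to the battery
states `(τ, τ')`, where `P'` is the projector of `τ'`. -/
def effectiveWorkProcess {X X' W : Type*} [Fintype X'] [DecidableEq X'] [Fintype W] [DecidableEq W]
    (Φ : Matrix (X × W) (X × W) ℂ →ₗ[ℂ] Matrix (X' × W) (X' × W) ℂ) (τ τ' : BatteryState W) :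
    Matrix X X ℂ →ₗ[ℂ] Matrix X' X' ℂ where
  toFun A := trRight (((1 : Matrix X' X' ℂ) ⊗ₖ τ'.proj) * Φ (A ⊗ₖ τ.state))
  map_add' A B := by
    ext i j
    simp [trRight, Matrix.add_kronecker, Matrix.mul_add, Finset.sum_add_distrib]
  map_smul' c A := by
    ext i j
    simp [trRight, Matrix.smul_kronecker, Finset.mul_sum]

end

end ThermalErasure

open ThermalErasure

/-! Let the bath contain n = N + 1 copies of S, each in its Gibbs state. Exchanging S with any copy
k conserves energy, and once the bath is discarded it leaves exactly γ_S ⊗ ρ_MR. Doing this with a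
uniformly random k, held in a battery register that is maximally mixed over n values, costs nothing.
Work is gained by then resetting the register to a fixed value, which is possible if k can be read
off from system and bath. After the exchange, M is correlated as in ρ_SM with copy k only; with
every other copy it is in γ_S ⊗ ρ_M. A test that accepts ρ_SM with probability at least 1 - ε and
γ_S ⊗ ρ_M with probability at most δ = 2 exp(-D) therefore locates k as long as N δ ≤ ε. This allows
n ≥ (ε/2) exp D and gives a gain of ln n.

Formally, let `F k` be the exchanges, Γ the Gibbs state of the bath and `L k` operators that
conserve energy and satisfy ∑ L_k L_k† = 1. The column of the L_k† is an isometry; an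
energy-preserving unitary dilates it and realizes the work process (1/n) ∑ tr_B[L_k (· ⊗ Γ) L_k†]
(`exists_thermalOperation_of_row`). The target is the same expression with L_k = F_k. Comparing
purifications bounds the fidelity below by the average of Re tr[L_k† F_k (ρ_SM ⊗ Γ)], where R no
longer appears (`overlap_le_fidelity`).

The L_k come from testing the positions one after the other (`exists_decoding_row`). A union bound
for amplitudes (`one_sub_trace_le_of_sequence`) makes each overlap at least 1 - 2(N δ + ε) ≥ 1 - 4ε.
Energy conservation requires a test that commutes with H_S + H_M; pinching supplies one at no loss,
since ρ_SM and γ_S ⊗ ρ_M both commute with this Hamiltonian. -/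

namespace ThermalErasure

/-! ### Contractions, fidelity, gentle measurement and pinching. -/

section PositiveMatrices

theorem trace_conjTranspose_re {X : Type*} [Fintype X] (A : Matrix X X ℂ) : Aᴴ.trace.re = A.trace.re := by
  rw [Matrix.trace_conjTranspose]; simp

variable {X Y : Type*} [Fintype X] [DecidableEq X] [Fintype Y]

theorem trace_mul_re_nonneg {P ω : Matrix X X ℂ} (hP : P.PosSemidef) (hω : ω.PosSemidef) :
    0 ≤ (P * ω).trace.re := by
  obtain ⟨G, rfl⟩ := CStarAlgebra.nonneg_iff_eq_star_mul_self.mp hω.nonneg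
  rw [star_eq_conjTranspose, ← Matrix.mul_assoc, Matrix.trace_mul_comm, ← Matrix.mul_assoc]
  exact (Complex.nonneg_iff.mp (hP.mul_mul_conjTranspose_same G).trace_nonneg).1

theorem trace_mul_re_mono {P Q ω : Matrix X X ℂ} (h : (Q - P).PosSemidef) (hω : ω.PosSemidef) :
    (P * ω).trace.re ≤ (Q * ω).trace.re := by
  have := trace_mul_re_nonneg h hω
  rw [Matrix.sub_mul, Matrix.trace_sub, Complex.sub_re] at this
  linarith

/-- Douglas factorization: `G = D V` with a contraction `V`, as soon as `G G† = D²` with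
`D` Hermitian. -/
theorem exists_contraction_of_mul_conjTranspose_eq {D : Matrix X X ℂ} (hD : D.IsHermitian)
    (G : Matrix X Y ℂ) (h : G * Gᴴ = D * D) :
    ∃ V : Matrix X Y ℂ, G = D * V ∧ (1 - V * Vᴴ).PosSemidef := by
  have hc : ∀ f : ℝ → ℝ, ContinuousOn f (spectrum ℝ D) := fun f =>
    (Matrix.finite_real_spectrum (A := D)).continuousOn f
  have hsa : IsSelfAdjoint D := hD
  -- Since `0⁻¹ = 0`, this is the Moore–Penrose inverse of D, and D P is the projector onto the
  -- range of D. The contraction is V = P G.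
  set P : Matrix X X ℂ := cfc (fun x : ℝ => x⁻¹) D with hPdef
  have hPh : Pᴴ = P := (cfc_predicate (fun x : ℝ => x⁻¹) D : IsSelfAdjoint _)
  have hid : D = cfc (fun x : ℝ => x) D := (cfc_id' ℝ D).symm
  have hDP : D * P = cfc (fun x : ℝ => x * x⁻¹) D := by
    conv_lhs => rw [hPdef]; enter [1]; rw [hid]
    rw [← cfc_mul _ _ D (hc _) (hc _)]
  have hPD : P * D = D * P := by
    have : Commute D P := (Commute.cfc_real (Commute.refl D) _).symm
    exact this.eq.symm
  have hDPD : D * P * D = D := by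
    rw [hDP]
    conv_lhs => enter [2]; rw [hid]
    rw [← cfc_mul _ _ D (hc _) (hc _)]
    conv_rhs => rw [hid]
    congr 1
    ext x
    by_cases hx : x = 0 <;> simp [hx]
  have hidem : (D * P) * (D * P) = D * P := by
    rw [← Matrix.mul_assoc, hDPD]
  have hherm : (D * P)ᴴ = D * P := by
    rw [Matrix.conjTranspose_mul, hPh, hD.eq, hPD]
  refine ⟨P * G, ?_, ?_⟩
  · have h0 : ((1 - D * P) * G) * ((1 - D * P) * G)ᴴ = 0 := by
      rw [Matrix.conjTranspose_mul, Matrix.conjTranspose_sub, hherm, Matrix.conjTranspose_one]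
      calc (1 - D * P) * G * (Gᴴ * (1 - D * P)) = (1 - D * P) * (G * Gᴴ) * (1 - D * P) := by
            simp only [Matrix.mul_assoc]
        _ = (D - D * P * D) * D * (1 - D * P) := by rw [h]; noncomm_ring
        _ = 0 := by rw [hDPD]; simp
    have h1 := Matrix.self_mul_conjTranspose_eq_zero.mp h0
    rw [Matrix.sub_mul, Matrix.one_mul, sub_eq_zero] at h1
    rw [← Matrix.mul_assoc]; exact h1
  · have : 1 - P * G * (P * G)ᴴ = (1 - D * P) * (1 - D * P)ᴴ := by
      rw [Matrix.conjTranspose_mul, Matrix.conjTranspose_sub, hherm, Matrix.conjTranspose_one, hPh]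
      calc 1 - P * G * (Gᴴ * P) = 1 - P * (G * Gᴴ) * P := by simp only [Matrix.mul_assoc]
        _ = 1 - (P * D) * (D * P) := by rw [h]; simp only [Matrix.mul_assoc]
        _ = 1 - D * P := by rw [hPD, hidem]
        _ = 1 - D * P - D * P + D * P := by abel
        _ = 1 - D * P - D * P + D * P * (D * P) := by rw [hidem]
        _ = _ := by noncomm_ring
    rw [this]
    exact Matrix.posSemidef_self_mul_conjTranspose _

/-- From (1 - C)(1 - C)† ≥ 0 and C C† ≤ 1 follows C + C† ≤ 2; pair this with P. -/
theorem trace_mul_contraction_re_le {P C : Matrix X X ℂ} (hP : P.PosSemidef)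
    (hC : (1 - C * Cᴴ).PosSemidef) : (P * C).trace.re ≤ P.trace.re := by
  have h1 : (1 + 1 - C - Cᴴ).PosSemidef := by
    have : (1 + 1 - C - Cᴴ) = (1 - C) * (1 - C)ᴴ + (1 - C * Cᴴ) := by
      rw [Matrix.conjTranspose_sub, Matrix.conjTranspose_one]; noncomm_ring
    rw [this]
    exact (Matrix.posSemidef_self_mul_conjTranspose _).add hC
  have h2 := trace_mul_re_nonneg h1 hP
  have h3 : (Cᴴ * P).trace.re = (P * C).trace.re := by
    rw [← trace_conjTranspose_re (P * C), Matrix.conjTranspose_mul, hP.isHermitian.eq]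
  have h4 : (C * P).trace.re = (P * C).trace.re := by rw [Matrix.trace_mul_comm]
  simp only [Matrix.sub_mul, Matrix.add_mul, Matrix.one_mul, Matrix.trace_sub, Matrix.trace_add,
    Complex.sub_re, Complex.add_re, h3, h4] at h2
  linarith

theorem contraction_mul {C D : Matrix X X ℂ} (hC : (1 - C * Cᴴ).PosSemidef)
    (hD : (1 - D * Dᴴ).PosSemidef) : (1 - (C * D) * (C * D)ᴴ).PosSemidef := by
  have : 1 - (C * D) * (C * D)ᴴ = (1 - C * Cᴴ) + C * (1 - D * Dᴴ) * Cᴴ := by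
    rw [Matrix.conjTranspose_mul]; noncomm_ring
  rw [this]
  exact hC.add (hD.mul_mul_conjTranspose_same C)

/-- Both conditions are Schur complements of one block matrix, with diagonal blocks 1 and
off-diagonal blocks V and V†. -/
theorem contraction_conjTranspose [DecidableEq Y] {V : Matrix X Y ℂ} (hV : (1 - V * Vᴴ).PosSemidef) :
    (1 - Vᴴ * V).PosSemidef := by
  let : Invertible (1 : Matrix X X ℂ) := invertibleOne
  let : Invertible (1 : Matrix Y Y ℂ) := invertibleOne
  have h1 : (fromBlocks 1 V Vᴴ 1).PosSemidef :=
    (Matrix.PosDef.fromBlocks₂₂ (1 : Matrix X X ℂ) V (Matrix.PosDef.one (n := Y))).mpr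
      (by simpa using hV)
  simpa using (Matrix.PosDef.fromBlocks₁₁ V (1 : Matrix Y Y ℂ) (Matrix.PosDef.one (n := X))).mp h1

/-- Douglas factorization of A† gives a polar form A = V† |A| with V a contraction, so the previous
bound applies to |A| and the contraction C V†. -/
theorem trace_mul_contraction_re_le_traceNorm (A C : Matrix X X ℂ)
    (hC : (1 - C * Cᴴ).PosSemidef) : (A * C).trace.re ≤ traceNorm A := by
  have hpos := Matrix.posSemidef_conjTranspose_mul_self A
  have hs : (CFC.sqrt (Aᴴ * A)).PosSemidef := (CFC.sqrt_nonneg _).posSemidef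
  obtain ⟨V, hV, hVc⟩ := exists_contraction_of_mul_conjTranspose_eq hs.isHermitian Aᴴ
    (by rw [Matrix.conjTranspose_conjTranspose, CFC.sqrt_mul_sqrt_self _ hpos.nonneg])
  have hA : A = Vᴴ * CFC.sqrt (Aᴴ * A) := by
    conv_lhs => rw [← Matrix.conjTranspose_conjTranspose A, hV]
    rw [Matrix.conjTranspose_mul, hs.isHermitian.eq]
  have hVc' : (1 - Vᴴ * Vᴴᴴ).PosSemidef := by
    rw [Matrix.conjTranspose_conjTranspose]; exact contraction_conjTranspose hVc
  calc (A * C).trace.re = (CFC.sqrt (Aᴴ * A) * (C * Vᴴ)).trace.re := by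
        conv_lhs => rw [hA]
        rw [Matrix.mul_assoc, Matrix.trace_mul_comm, Matrix.mul_assoc]
    _ ≤ _ := trace_mul_contraction_re_le hs (contraction_mul hC hVc')

/-- Overlaps of purifications bound the fidelity from below. -/
theorem trace_conjTranspose_mul_re_le_fidelity [DecidableEq Y] (G K : Matrix X Y ℂ) :
    (Gᴴ * K).trace.re ≤ fidelity (G * Gᴴ) (K * Kᴴ) := by
  have hG := Matrix.posSemidef_self_mul_conjTranspose G
  have hK := Matrix.posSemidef_self_mul_conjTranspose K
  have hsG : (CFC.sqrt (G * Gᴴ)).PosSemidef := (CFC.sqrt_nonneg _).posSemidef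
  have hsK : (CFC.sqrt (K * Kᴴ)).PosSemidef := (CFC.sqrt_nonneg _).posSemidef
  obtain ⟨V, hV, hVc⟩ := exists_contraction_of_mul_conjTranspose_eq hsG.isHermitian G
    (CFC.sqrt_mul_sqrt_self _ hG.nonneg).symm
  obtain ⟨W, hW, hWc⟩ := exists_contraction_of_mul_conjTranspose_eq hsK.isHermitian K
    (CFC.sqrt_mul_sqrt_self _ hK.nonneg).symm
  have hc : (1 - (W * Vᴴ) * (W * Vᴴ)ᴴ).PosSemidef := by
    have : 1 - (W * Vᴴ) * (W * Vᴴ)ᴴ = (1 - W * Wᴴ) + W * (1 - Vᴴ * V) * Wᴴ := by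
      rw [Matrix.conjTranspose_mul, Matrix.conjTranspose_conjTranspose, Matrix.mul_sub,
        Matrix.sub_mul, Matrix.mul_one]
      simp only [Matrix.mul_assoc]; abel
    rw [this]
    exact hWc.add ((contraction_conjTranspose hVc).mul_mul_conjTranspose_same W)
  calc (Gᴴ * K).trace.re
      = (CFC.sqrt (G * Gᴴ) * CFC.sqrt (K * Kᴴ) * (W * Vᴴ)).trace.re := by
        have : Gᴴ * K = Vᴴ * (CFC.sqrt (G * Gᴴ) * CFC.sqrt (K * Kᴴ) * W) := by
          conv_lhs => enter [1]; rw [hV]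
          conv_lhs => enter [2]; rw [hW]
          rw [Matrix.conjTranspose_mul, hsG.isHermitian.eq]
          simp only [Matrix.mul_assoc]
        rw [this, Matrix.trace_mul_comm]
        simp only [Matrix.mul_assoc]
    _ ≤ _ := trace_mul_contraction_re_le_traceNorm _ _ hc

/-- 2(1 - C) = (1 - C)² + (1 - C²). -/
theorem one_sub_posSemidef_of_sq {C : Matrix X X ℂ} (hC : C.IsHermitian)
    (h : (1 - C * C).PosSemidef) : (1 - C).PosSemidef := by
  have : 1 - C = (2⁻¹ : ℝ) • ((1 - C) * (1 - C)ᴴ + (1 - C * C)) := by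
    rw [Matrix.conjTranspose_sub, Matrix.conjTranspose_one, hC.eq]
    have : (1 - C) * (1 - C) + (1 - C * C) = (2 : ℝ) • (1 - C) := by
      rw [two_smul]; noncomm_ring
    rw [this, smul_smul]; norm_num
  rw [this]
  exact ((Matrix.posSemidef_self_mul_conjTranspose _).add h).smul (by norm_num)

/-- C - C² = C(1 - C)C + (1 - C)C(1 - C). -/
theorem sub_sq_posSemidef {C : Matrix X X ℂ} (hC : C.PosSemidef) (h : (1 - C).PosSemidef) :
    (C - C * C).PosSemidef := by
  have : C - C * C = C * (1 - C) * Cᴴ + (1 - C) * C * (1 - C)ᴴ := by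
    rw [Matrix.conjTranspose_sub, Matrix.conjTranspose_one, hC.isHermitian.eq]; noncomm_ring
  rw [this]
  exact (h.mul_mul_conjTranspose_same C).add (hC.mul_mul_conjTranspose_same (1 - C))

/-- The square root of an effect, with the properties used for gentle measurements. -/
theorem exists_sqrt_effect {Q : Matrix X X ℂ} (hQ : Q.PosSemidef) (hQ1 : (1 - Q).PosSemidef) :
    ∃ B : Matrix X X ℂ, B.PosSemidef ∧ (1 - B).PosSemidef ∧ B * B = Q ∧ (B - Q).PosSemidef ∧
      ∀ H, Commute Q H → Commute B H := by
  have hB : (CFC.sqrt Q).PosSemidef := (CFC.sqrt_nonneg _).posSemidef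
  have hBB : CFC.sqrt Q * CFC.sqrt Q = Q := CFC.sqrt_mul_sqrt_self _ hQ.nonneg
  have h1 := one_sub_posSemidef_of_sq hB.isHermitian (by rwa [hBB])
  refine ⟨CFC.sqrt Q, hB, h1, hBB, ?_, fun H hH => ?_⟩
  · have := sub_sq_posSemidef hB h1
    rwa [hBB] at this
  · exact hH.cfcₙ_nnreal _

/-- Sequential union bound for gentle measurements: if every effect of a sequence nearly holds in
the state `ω`, then applying all of them leaves `ω` nearly undisturbed. -/
theorem one_sub_trace_le_of_sequence {ω : Matrix X X ℂ} (hω : ω.PosSemidef) (hω1 : ω.trace = 1)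
    (A W : ℕ → Matrix X X ℂ) (hW0 : W 0 = 1) (hW : ∀ k, W (k + 1) = A k * W k) (N : ℕ)
    (hA : ∀ k < N, (A k).PosSemidef) (hA1 : ∀ k < N, (1 - A k).PosSemidef) :
    1 - (W N * ω).trace.re ≤ 2 * ∑ k ∈ Finset.range N, ((1 - A k) * ω).trace.re := by
  -- The term (1 - tr[W†W ω])/4 strengthens the induction hypothesis so that the errors telescope;
  -- errors of the separate steps then add linearly, without square roots.
  have key : ∀ k ≤ N, 1 - (W k * ω).trace.re ≤ (1 - ((W k)ᴴ * W k * ω).trace.re) / 4 +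
      ∑ i ∈ Finset.range k, ((1 - A i) * ω).trace.re := by
    intro k
    induction k with
    | zero => intro _; simp [hW0, hω1]
    | succ k ih =>
      intro hk
      have ih := ih (by omega)
      have hAk := hA k (by omega)
      have hA1k := hA1 k (by omega)
      -- Expanding (W/2 - 1)†(1 - A)(W/2 - 1) ≥ 0 bounds the loss Re tr[(W - A W) ω] by a quarter of
      -- tr[W†(1 - A)W ω] plus tr[(1 - A) ω]. The inequality A² ≤ A then replaces W†A W by the next
      -- W†W.
      have h1 := trace_mul_re_nonneg
        (hA1k.conjTranspose_mul_mul_same ((2⁻¹ : ℝ) • W k - 1)) hω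
      have h2 := trace_mul_re_nonneg
        ((sub_sq_posSemidef hAk hA1k).conjTranspose_mul_mul_same (W k)) hω
      have e1 : ((2⁻¹ : ℝ) • W k - 1)ᴴ * (1 - A k) * ((2⁻¹ : ℝ) • W k - 1) =
          (4⁻¹ : ℝ) • ((W k)ᴴ * W k - (W k)ᴴ * A k * W k) + (1 - A k)
            - (2⁻¹ : ℝ) • (W k - A k * W k) - (2⁻¹ : ℝ) • (W k - A k * W k)ᴴ := by
        simp only [Matrix.conjTranspose_sub, Matrix.conjTranspose_smul, Matrix.conjTranspose_one,
          Matrix.conjTranspose_mul, star_trivial, Matrix.sub_mul, Matrix.mul_sub,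
          Matrix.smul_mul, Matrix.mul_smul, Matrix.one_mul, Matrix.mul_one, smul_sub, smul_smul,
          hAk.isHermitian.eq]
        norm_num
        abel
      have e3 : ((W k - A k * W k)ᴴ * ω).trace.re = (W k * ω).trace.re
          - (W (k + 1) * ω).trace.re := by
        rw [← Complex.sub_re, ← Matrix.trace_sub, ← Matrix.sub_mul, hW,
          ← trace_conjTranspose_re ((W k - A k * W k) * ω), Matrix.conjTranspose_mul,
          hω.isHermitian.eq, Matrix.trace_mul_comm]
      have e4 : ((W k - A k * W k) * ω).trace.re = (W k * ω).trace.re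
          - (W (k + 1) * ω).trace.re := by
        rw [← Complex.sub_re, ← Matrix.trace_sub, ← Matrix.sub_mul, hW]
      have e5 : (W (k + 1))ᴴ * W (k + 1) = (W k)ᴴ * (A k * A k) * W k := by
        rw [hW, Matrix.conjTranspose_mul, hAk.isHermitian.eq]; simp only [Matrix.mul_assoc]
      rw [e1] at h1
      rw [Matrix.mul_sub, Matrix.sub_mul, ← e5] at h2
      simp only [Matrix.sub_mul (M := _ - _), Matrix.sub_mul (M := _ + _), Matrix.add_mul,
        Matrix.smul_mul, Matrix.trace_sub, Matrix.trace_add, Matrix.trace_smul, Complex.sub_re,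
        Complex.add_re, Complex.real_smul, Complex.re_ofReal_mul, e3, e4] at h1
      simp only [Matrix.sub_mul, Matrix.trace_sub, Complex.sub_re] at h1 h2
      rw [Finset.sum_range_succ]
      simp only [Matrix.sub_mul, Matrix.trace_sub, Complex.sub_re] at ih ⊢
      linarith
  have h := key N le_rfl
  -- (W - 1)†(W - 1) ≥ 0 gives 1 - tr[W†W ω] ≤ 2(1 - Re tr[W ω]). The extra term of `key` is thus at
  -- most half of the left-hand side, whence the factor 2.
  have h1 := trace_mul_re_nonneg (Matrix.posSemidef_conjTranspose_mul_self (W N - 1)) hω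
  have e1 : (W N - 1)ᴴ * (W N - 1) = (W N)ᴴ * W N - W N - (W N)ᴴ + 1 := by
    rw [Matrix.conjTranspose_sub, Matrix.conjTranspose_one]; noncomm_ring
  have e2 : ((W N)ᴴ * ω).trace.re = (W N * ω).trace.re := by
    rw [← trace_conjTranspose_re (W N * ω), Matrix.conjTranspose_mul, hω.isHermitian.eq,
      Matrix.trace_mul_comm]
  rw [e1] at h1
  simp only [Matrix.sub_mul, Matrix.add_mul, Matrix.one_mul, Matrix.trace_sub, Matrix.trace_add,
    Complex.sub_re, Complex.add_re, e2, hω1, Complex.one_re] at h1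
  simp only [Matrix.sub_mul, Matrix.trace_sub, Complex.sub_re] at h ⊢
  linarith

/-- Pinching an effect in the eigenspaces of `H`: the expectation values in states that commute
with `H` do not change. -/
theorem exists_pinching {H : Matrix X X ℂ} (hH : H.IsHermitian) {Q : Matrix X X ℂ}
    (hQ : Q.PosSemidef) (hQ1 : (1 - Q).PosSemidef) :
    ∃ Q' : Matrix X X ℂ, Q'.PosSemidef ∧ (1 - Q').PosSemidef ∧ Commute Q' H ∧
      ∀ ρ, Commute ρ H → (Q' * ρ).trace = (Q * ρ).trace := by
  have hc : ∀ f : ℝ → ℝ, ContinuousOn f (spectrum ℝ H) := fun f =>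
    (Matrix.finite_real_spectrum (A := H)).continuousOn f
  have hsa : IsSelfAdjoint H := hH
  let s : Finset ℝ := (Matrix.finite_real_spectrum (A := H)).toFinset
  -- Spectral projectors of H. The pinched effect is ∑ P_c Q P_c.
  let P : ℝ → Matrix X X ℂ := fun c => cfc (fun x : ℝ => if x = c then (1 : ℝ) else 0) H
  have hPh : ∀ c, (P c)ᴴ = P c := fun c => (cfc_predicate (_ : ℝ → ℝ) H : IsSelfAdjoint _)
  have hPP : ∀ c, P c * P c = P c := fun c => by
    simp only [P]
    rw [← cfc_mul _ _ H (hc _) (hc _)]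
    congr 1; ext x; split_ifs <;> simp
  have hsum : ∑ c ∈ s, P c = 1 := by
    simp only [P]
    rw [← cfc_sum _ _ _ (fun _ _ => hc _), ← cfc_one ℝ H]
    apply cfc_congr
    intro x hx
    have : x ∈ s := by simpa [s] using hx
    simp [Finset.sum_apply, this]
  have hid : H = cfc (fun x : ℝ => x) H := (cfc_id' ℝ H).symm
  have hPcomm : ∀ c ρ, Commute ρ H → Commute (P c) ρ := fun c ρ h => h.symm.cfc_real _
  have hHP : ∀ c, H * P c = c • P c := fun c => by
    simp only [P]
    conv_lhs => enter [1]; rw [hid]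
    rw [← cfc_mul _ _ H (hc _) (hc _), ← cfc_const_mul _ _ H (hc _)]
    congr 1; ext x; split_ifs with h <;> simp [h]
  have hPH : ∀ c, P c * H = c • P c := fun c => by
    rw [← hHP]; exact hPcomm c H (Commute.refl H)
  have hpsd : ∀ T : Matrix X X ℂ, T.PosSemidef → (∑ c ∈ s, P c * T * P c).PosSemidef := by
    intro T hT
    refine Matrix.posSemidef_sum _ fun c _ => ?_
    have := hT.mul_mul_conjTranspose_same (P c)
    rwa [hPh] at this
  refine ⟨∑ c ∈ s, P c * Q * P c, hpsd Q hQ, ?_, ?_, ?_⟩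
  · have : 1 - ∑ c ∈ s, P c * Q * P c = ∑ c ∈ s, P c * (1 - Q) * P c := by
      simp only [Matrix.mul_sub, Matrix.sub_mul, Matrix.mul_one, hPP, Finset.sum_sub_distrib, hsum]
    rw [this]
    exact hpsd _ hQ1
  · change _ * H = H * _
    rw [Finset.sum_mul, Finset.mul_sum]
    refine Finset.sum_congr rfl fun c _ => ?_
    rw [Matrix.mul_assoc, hPH, ← Matrix.mul_assoc, ← Matrix.mul_assoc, hHP]
    simp
  · intro ρ hρ
    rw [Finset.sum_mul, Matrix.trace_sum]
    have : ∀ c ∈ s, (P c * Q * P c * ρ).trace = (Q * ρ * P c).trace := by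
      intro c _
      rw [Matrix.mul_assoc, (hPcomm c ρ hρ).eq, Matrix.mul_assoc, Matrix.trace_mul_comm]
      simp only [Matrix.mul_assoc, hPP]
    rw [Finset.sum_congr rfl this, ← Matrix.trace_sum, ← Finset.mul_sum, hsum, Matrix.mul_one]

end PositiveMatrices

end ThermalErasure

namespace ThermalErasure

/-! ### Gibbs states in an energy eigenbasis and for several copies. -/

section Gibbs

variable {X : Type*} [Fintype X]

theorem gibbs_conj [DecidableEq X] (β : ℝ) (H : Matrix X X ℂ) {V : Matrix X X ℂ} (hV : Vᴴ * V = 1) :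
    gibbs β (V * H * Vᴴ) = V * gibbs β H * Vᴴ := by
  have hV' : V * Vᴴ = 1 := mul_eq_one_comm.mp hV
  have hinv : V⁻¹ = Vᴴ := Matrix.inv_eq_right_inv hV'
  have hu : IsUnit V := ⟨⟨V, Vᴴ, hV', hV⟩, rfl⟩
  have he : NormedSpace.exp ((-β : ℂ) • (V * H * Vᴴ)) =
      V * NormedSpace.exp ((-β : ℂ) • H) * Vᴴ := by
    rw [← hinv, ← Matrix.exp_conj _ _ hu, Matrix.mul_smul, Matrix.smul_mul]
  unfold gibbs
  rw [he, Matrix.mul_smul, Matrix.smul_mul, Matrix.trace_mul_cycle, hV, Matrix.one_mul]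

/-- The Boltzmann weights of the energies `E`. -/
noncomputable def boltzmann (β : ℝ) (E : X → ℝ) (x : X) : ℝ :=
  (∑ y, Real.exp (-β * E y))⁻¹ * Real.exp (-β * E x)

theorem boltzmann_nonneg (β : ℝ) (E : X → ℝ) (x : X) : 0 ≤ boltzmann β E x := by
  unfold boltzmann; positivity

theorem sum_boltzmann [Nonempty X] (β : ℝ) (E : X → ℝ) : ∑ x, boltzmann β E x = 1 := by
  unfold boltzmann
  rw [← Finset.mul_sum]
  exact inv_mul_cancel₀ (Finset.sum_pos (fun _ _ => Real.exp_pos _) Finset.univ_nonempty).ne'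

theorem gibbs_diagonal [DecidableEq X] (β : ℝ) (E : X → ℝ) :
    gibbs β (diagonal fun x => (E x : ℂ)) = diagonal fun x => (boltzmann β E x : ℂ) := by
  have he : NormedSpace.exp ((-β : ℂ) • diagonal fun x => (E x : ℂ)) =
      diagonal fun x => ((Real.exp (-β * E x) : ℝ) : ℂ) := by
    rw [← Matrix.diagonal_smul, Matrix.exp_diagonal]
    congr 1
    funext x
    rw [Pi.coe_exp, ← Complex.exp_eq_exp_ℂ]
    simp
  unfold gibbs
  rw [he, Matrix.trace_diagonal, ← Matrix.diagonal_smul]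
  congr 1
  funext x
  simp [boltzmann]

theorem posSemidef_gibbs [DecidableEq X] (β : ℝ) {H : Matrix X X ℂ} (hH : H.IsHermitian) :
    (gibbs β H).PosSemidef := by
  have hV := Unitary.coe_star_mul_self hH.eigenvectorUnitary
  have h := hH.spectral_theorem
  rw [Unitary.conjStarAlgAut_apply] at h
  rw [h]
  refine (gibbs_conj β _ hV).symm ▸ Matrix.PosSemidef.mul_mul_conjTranspose_same ?_ _
  refine (gibbs_diagonal β hH.eigenvalues).symm ▸ Matrix.posSemidef_diagonal_iff.mpr fun x => ?_
  exact Complex.zero_le_real.mpr (boltzmann_nonneg _ _ _)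

theorem commute_gibbs [DecidableEq X] (β : ℝ) (H : Matrix X X ℂ) : Commute (gibbs β H) H :=
  Commute.smul_left (Commute.exp_right ((Commute.refl H).smul_right _)).symm _

/-- For additive energies both the exponential and the partition function factorize, so the bath is
in a product of Gibbs states. -/
theorem boltzmann_pi {ι : Type*} [Fintype ι] [DecidableEq ι] (β : ℝ) (E : X → ℝ) (b : ι → X) :
    boltzmann β (fun b : ι → X => ∑ k, E (b k)) b = ∏ k, boltzmann β E (b k) := by
  unfold boltzmann
  have h : ∀ b : ι → X, Real.exp (-β * ∑ k, E (b k)) = ∏ k, Real.exp (-β * E (b k)) := fun b => by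
    rw [Finset.mul_sum, Real.exp_sum]
  simp only [h]
  rw [Finset.prod_mul_distrib, Finset.prod_inv_distrib, Finset.prod_univ_sum,
    Fintype.piFinset_univ]

/-- Marginals of a product of probability vectors. -/
theorem sum_mul_prod_erase {ι : Type*} [Fintype ι] [DecidableEq ι] (p : X → ℂ)
    (hp : ∑ x, p x = 1) (f : X → ℂ) (j : ι) :
    ∑ b : ι → X, f (b j) * ∏ k ∈ Finset.univ.erase j, p (b k) = ∑ x, f x := by
  have h : ∀ b : ι → X, f (b j) * ∏ k ∈ Finset.univ.erase j, p (b k) =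
      ∏ k, (if k = j then f else p) (b k) := fun b => by
    rw [← Finset.mul_prod_erase _ _ (Finset.mem_univ j), if_pos rfl]
    congr 1
    exact Finset.prod_congr rfl fun k hk => by rw [if_neg (Finset.ne_of_mem_erase hk)]
  simp only [h]
  rw [← Fintype.piFinset_univ, ← Finset.prod_univ_sum,
    ← Finset.mul_prod_erase _ _ (Finset.mem_univ j), if_pos rfl,
    Finset.prod_eq_one fun k hk => by rw [if_neg (Finset.ne_of_mem_erase hk), hp], mul_one]

end Gibbs

/-! ### Partial traces. -/

section PartialTrace

variable {X Y : Type*} [Fintype X] [Fintype Y]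

theorem trace_trRight (A : Matrix (X × Y) (X × Y) ℂ) : (trRight A).trace = A.trace := by
  simp [Matrix.trace, trRight, Fintype.sum_prod_type]

theorem kronecker_one_mul_apply [DecidableEq Y] (C : Matrix X X ℂ) (A : Matrix (X × Y) (X × Y) ℂ) (x : X) (y : Y)
    (z : X × Y) : ((C ⊗ₖ (1 : Matrix Y Y ℂ)) * A) (x, y) z = ∑ x', C x x' * A (x', y) z := by
  simp [Matrix.mul_apply, Fintype.sum_prod_type, Matrix.one_apply]

theorem mul_kronecker_one_apply [DecidableEq Y] (C : Matrix X X ℂ) (A : Matrix (X × Y) (X × Y) ℂ) (x : X) (y : Y)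
    (z : X × Y) : (A * (C ⊗ₖ (1 : Matrix Y Y ℂ))) z (x, y) = ∑ x', A z (x', y) * C x' x := by
  simp [Matrix.mul_apply, Fintype.sum_prod_type, Matrix.one_apply]

theorem trRight_kronecker_one_mul [DecidableEq Y] (C : Matrix X X ℂ) (A : Matrix (X × Y) (X × Y) ℂ) :
    trRight ((C ⊗ₖ (1 : Matrix Y Y ℂ)) * A) = C * trRight A := by
  ext x x'
  simp only [trRight, Matrix.of_apply, kronecker_one_mul_apply]
  simp only [Matrix.mul_apply, Matrix.of_apply, Finset.mul_sum]
  exact Finset.sum_comm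

theorem trRight_mul_kronecker_one [DecidableEq Y] (C : Matrix X X ℂ) (A : Matrix (X × Y) (X × Y) ℂ) :
    trRight (A * (C ⊗ₖ (1 : Matrix Y Y ℂ))) = trRight A * C := by
  ext x x'
  simp only [trRight, Matrix.of_apply, mul_kronecker_one_apply]
  simp only [Matrix.mul_apply, Matrix.of_apply, Finset.sum_mul]
  exact Finset.sum_comm

/-- Cyclicity of the partial trace, valid for operators on the factor traced out. -/
theorem trLeft_kronecker_one_mul_comm [DecidableEq Y] (C : Matrix X X ℂ) (A : Matrix (X × Y) (X × Y) ℂ) :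
    trLeft ((C ⊗ₖ (1 : Matrix Y Y ℂ)) * A) = trLeft (A * (C ⊗ₖ (1 : Matrix Y Y ℂ))) := by
  ext y y'
  simp only [trLeft, Matrix.of_apply, kronecker_one_mul_apply, mul_kronecker_one_apply]
  rw [Finset.sum_comm]
  simp only [mul_comm]

theorem trLeft_one_kronecker_mul [DecidableEq X] (C : Matrix Y Y ℂ) (A : Matrix (X × Y) (X × Y) ℂ) :
    trLeft (((1 : Matrix X X ℂ) ⊗ₖ C) * A) = C * trLeft A := by
  ext y y'
  simp only [trLeft, Matrix.of_apply, Matrix.mul_apply, Fintype.sum_prod_type,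
    Matrix.kronecker_apply, Matrix.one_apply, Finset.mul_sum]
  simp only [ite_mul, one_mul, zero_mul, Finset.sum_ite_irrel, Finset.sum_const_zero]
  simp only [Finset.sum_ite_eq, Finset.mem_univ, if_true]
  exact Finset.sum_comm

theorem trLeft_mul_one_kronecker [DecidableEq X] (C : Matrix Y Y ℂ) (A : Matrix (X × Y) (X × Y) ℂ) :
    trLeft (A * ((1 : Matrix X X ℂ) ⊗ₖ C)) = trLeft A * C := by
  ext y y'
  simp only [trLeft, Matrix.of_apply, Matrix.mul_apply, Fintype.sum_prod_type,
    Matrix.kronecker_apply, Matrix.one_apply, Finset.sum_mul]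
  simp only [ite_mul, mul_ite, one_mul, mul_zero, zero_mul, Finset.sum_ite_irrel,
    Finset.sum_const_zero]
  simp only [Finset.sum_ite_eq', Finset.mem_univ, if_true]
  exact Finset.sum_comm

/-- Conjugating the first factor does not change the partial trace over it. -/
theorem trLeft_conj [DecidableEq X] [DecidableEq Y] (V : Matrix X X ℂ) (hV : V * Vᴴ = 1) (A : Matrix (X × Y) (X × Y) ℂ) :
    trLeft ((V ⊗ₖ (1 : Matrix Y Y ℂ))ᴴ * A * (V ⊗ₖ (1 : Matrix Y Y ℂ))) = trLeft A := by
  rw [← trLeft_kronecker_one_mul_comm, ← Matrix.mul_assoc, Matrix.conjTranspose_kronecker,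
    Matrix.conjTranspose_one, ← Matrix.mul_kronecker_mul, hV, Matrix.one_mul,
    Matrix.one_kronecker_one, Matrix.one_mul]

theorem trRight_kronecker {X : Type*} (A : Matrix X X ℂ) (B : Matrix Y Y ℂ) :
    trRight (A ⊗ₖ B) = B.trace • A := by
  ext x x'
  simp [trRight, Matrix.trace, mul_comm, Finset.mul_sum]

theorem posSemidef_trRight {X : Type*} {A : Matrix (X × Y) (X × Y) ℂ} (hA : A.PosSemidef) :
    (trRight A).PosSemidef := by
  have : trRight A = ∑ y, A.submatrix (fun x => (x, y)) (fun x => (x, y)) := by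
    ext x x'; simp [trRight, Matrix.sum_apply]
  rw [this]
  exact Matrix.posSemidef_sum _ fun y _ => hA.submatrix _

theorem posSemidef_trLeft {Y : Type*} {A : Matrix (X × Y) (X × Y) ℂ} (hA : A.PosSemidef) :
    (trLeft A).PosSemidef := by
  have : trLeft A = ∑ x, A.submatrix (fun y => (x, y)) (fun y => (x, y)) := by
    ext x x'; simp [trLeft, Matrix.sum_apply]
  rw [this]
  exact Matrix.posSemidef_sum _ fun x _ => hA.submatrix _

end PartialTrace

end ThermalErasure

namespace ThermalErasure

/-! ### The bath of copies of S and the energy-preserving exchanges. -/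

theorem totalHam_conj {X Y : Type*} [Fintype X] [DecidableEq X] [Fintype Y] [DecidableEq Y]
    {V : Matrix X X ℂ} (hV : V * Vᴴ = 1) (HX : Matrix X X ℂ) (HY : Matrix Y Y ℂ) :
    totalHam (V * HX * Vᴴ) HY =
      (V ⊗ₖ (1 : Matrix Y Y ℂ)) * totalHam HX HY * (V ⊗ₖ (1 : Matrix Y Y ℂ))ᴴ := by
  unfold totalHam
  rw [Matrix.conjTranspose_kronecker, Matrix.conjTranspose_one, Matrix.mul_add, Matrix.add_mul]
  simp only [← Matrix.mul_kronecker_mul, Matrix.mul_one, Matrix.one_mul, hV]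

section SwapBath

variable {S M ι : Type*} [DecidableEq ι]

/-- Exchange of the system `S` with the copy of `S` at the site `j` of the bath. -/
def siteSwap (j : ι) : Equiv.Perm ((S × M) × (ι → S)) :=
  Function.Involutive.toPerm (fun z => ((z.2 j, z.1.2), Function.update z.2 j z.1.1)) (by
    rintro ⟨⟨s, m⟩, b⟩
    simp)

theorem siteSwap_apply (j : ι) (s : S) (m : M) (b : ι → S) :
    siteSwap j ((s, m), b) = ((b j, m), Function.update b j s) := rfl

theorem siteSwap_siteSwap (j : ι) (z : (S × M) × (ι → S)) : siteSwap j (siteSwap j z) = z :=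
  (siteSwap j).left_inv z

variable [DecidableEq S] [DecidableEq M] [Fintype ι]

/-- The permutation matrix of `siteSwap`. -/
def swapMatrix (S M : Type*) {ι : Type*} [DecidableEq S] [DecidableEq M] [Fintype ι]
    [DecidableEq ι] (j : ι) : Matrix ((S × M) × (ι → S)) ((S × M) × (ι → S)) ℂ :=
  (1 : Matrix _ _ ℂ).submatrix (siteSwap j) (Equiv.refl _)

theorem swapMatrix_conjTranspose (j : ι) : (swapMatrix S M j)ᴴ = swapMatrix S M j := by
  ext z z'
  have h : siteSwap j z' = z ↔ siteSwap j z = z' := by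
    constructor <;> rintro rfl <;> exact siteSwap_siteSwap _ _
  change star ((1 : Matrix _ _ ℂ) (siteSwap j z') z) = (1 : Matrix _ _ ℂ) (siteSwap j z) z'
  by_cases hz : siteSwap j z = z'
  · rw [h.mpr hz, hz]; simp
  · rw [Matrix.one_apply_ne hz, Matrix.one_apply_ne (mt h.mp hz), star_zero]

variable [Fintype S] [Fintype M]

theorem swapMatrix_mul (j : ι) (A : Matrix ((S × M) × (ι → S)) ((S × M) × (ι → S)) ℂ) :
    swapMatrix S M j * A = A.submatrix (siteSwap j) id :=
  Matrix.one_submatrix_mul _ (Equiv.refl _) A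

theorem mul_swapMatrix (j : ι) (A : Matrix ((S × M) × (ι → S)) ((S × M) × (ι → S)) ℂ) :
    A * swapMatrix S M j = A.submatrix id (siteSwap j) :=
  Matrix.mul_submatrix_one (siteSwap j) _ A

theorem swapMatrix_mul_mul (j : ι) (A : Matrix ((S × M) × (ι → S)) ((S × M) × (ι → S)) ℂ) :
    swapMatrix S M j * A * swapMatrix S M j = A.submatrix (siteSwap j) (siteSwap j) := by
  rw [swapMatrix_mul, mul_swapMatrix]; rfl

theorem swapMatrix_mul_self (j : ι) : swapMatrix S M j * swapMatrix S M j = 1 := by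
  rw [swapMatrix_mul]
  ext z z'
  change (1 : Matrix _ _ ℂ) (siteSwap j (siteSwap j z)) z' = _
  rw [siteSwap_siteSwap]

/-- S and its copies carry the same energy function, so the total energy is invariant under the
exchange; M is not touched. -/
theorem swapMatrix_commute (E : S → ℂ) (HM : Matrix M M ℂ) (j : ι) :
    Commute (swapMatrix S M j) (totalHam (totalHam (diagonal E) HM)
      (diagonal fun b : ι → S => ∑ k, E (b k))) := by
  change _ * _ = _ * _
  rw [swapMatrix_mul, mul_swapMatrix]
  suffices h : (totalHam (totalHam (diagonal E) HM)
      (diagonal fun b : ι → S => ∑ k, E (b k))).submatrix (siteSwap j) (siteSwap j) =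
      totalHam (totalHam (diagonal E) HM) (diagonal fun b : ι → S => ∑ k, E (b k)) by
    ext z z'
    have := congrFun (congrFun h z) (siteSwap j z')
    simpa [siteSwap_siteSwap] using this
  have hup : ∀ (b b' : ι → S) (s s' : S), (b j = b' j ∧ Function.update b j s =
      Function.update b' j s') ↔ (s = s' ∧ b = b') := by
    intro b b' s s'
    constructor
    · rintro ⟨h1, h2⟩
      refine ⟨by simpa using congrFun h2 j, ?_⟩
      ext k
      by_cases hk : k = j
      · rw [hk, h1]
      · simpa [hk] using congrFun h2 k
    · rintro ⟨rfl, rfl⟩; exact ⟨rfl, rfl⟩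
  ext ⟨⟨s, m⟩, b⟩ ⟨⟨s', m'⟩, b'⟩
  by_cases h : s = s' ∧ b = b'
  · obtain ⟨rfl, rfl⟩ := h
    have hs : E (b j) + ∑ k, E (Function.update b j s k) = E s + ∑ k, E (b k) := by
      rw [← Finset.add_sum_erase _ _ (Finset.mem_univ j),
        ← Finset.add_sum_erase _ (fun k => E (b k)) (Finset.mem_univ j)]
      have : ∑ k ∈ Finset.univ.erase j, E (Function.update b j s k) =
          ∑ k ∈ Finset.univ.erase j, E (b k) :=
        Finset.sum_congr rfl fun k hk => by
          rw [Function.update_of_ne (Finset.ne_of_mem_erase hk)]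
      rw [this, Function.update_self]; ring
    by_cases hm : m = m'
    · subst hm
      simp only [totalHam, Matrix.submatrix_apply, siteSwap_apply, Matrix.add_apply,
        Matrix.kronecker_apply, Matrix.diagonal_apply_eq, Matrix.one_apply_eq, mul_one, one_mul]
      linear_combination hs
    · simp [totalHam, siteSwap_apply, hm]
  · have h' : ¬ (b j = b' j ∧ Function.update b j s = Function.update b' j s') := by rwa [hup]
    have gen : ∀ (t t' : S) (c c' : ι → S), ¬ (t = t' ∧ c = c') →
        totalHam (totalHam (diagonal E) HM) (diagonal fun b : ι → S => ∑ k, E (b k))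
          ((t, m), c) ((t', m'), c') = 0 := by
      intro t t' c c' hn
      by_cases ht : t = t'
      · have hc : c ≠ c' := fun hc => hn ⟨ht, hc⟩
        simp [totalHam, hc]
      · simp [totalHam, ht]
    rw [Matrix.submatrix_apply, siteSwap_apply, siteSwap_apply, gen _ _ _ _ h', gen _ _ _ _ h]

/-- The exchange brings a thermal copy into S and stores the old S at site j, where the trace over
the bath removes it. -/
theorem trRight_swap (p : S → ℂ) (hp : ∑ s, p s = 1) (j : ι) (A : Matrix (S × M) (S × M) ℂ) :
    trRight (swapMatrix S M j * (A ⊗ₖ diagonal fun b : ι → S => ∏ k, p (b k)) *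
      swapMatrix S M j) = diagonal p ⊗ₖ trLeft A := by
  rw [swapMatrix_mul_mul]
  ext ⟨s, m⟩ ⟨s', m'⟩
  simp only [trRight, Matrix.of_apply, Matrix.submatrix_apply, siteSwap_apply,
    Matrix.kronecker_apply]
  by_cases hs : s = s'
  · subst hs
    simp only [Matrix.diagonal_apply_eq, trLeft, Matrix.of_apply]
    rw [← sum_mul_prod_erase p hp (fun x => A (x, m) (x, m')) j, Finset.mul_sum]
    refine Finset.sum_congr rfl fun b _ => ?_
    rw [← Finset.mul_prod_erase _ _ (Finset.mem_univ j), Function.update_self]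
    have : ∏ k ∈ Finset.univ.erase j, p (Function.update b j s k) =
        ∏ k ∈ Finset.univ.erase j, p (b k) :=
      Finset.prod_congr rfl fun k hk => by
        rw [Function.update_of_ne (Finset.ne_of_mem_erase hk)]
    rw [this]; ring
  · have : ∀ b : ι → S, Function.update b j s ≠ Function.update b j s' := fun b h =>
      hs (by simpa using congrFun h j)
    simp [hs, this]

/-- After the exchange with j, site i still holds a fresh thermal copy independent of M. Looking for
the correlations at a wrong position i therefore shows the product state. -/
theorem trRight_swap_swap (p : S → ℂ) (hp : ∑ s, p s = 1) {i j : ι} (hij : i ≠ j)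
    (A : Matrix (S × M) (S × M) ℂ) :
    trRight (swapMatrix S M i * (swapMatrix S M j *
      (A ⊗ₖ diagonal fun b : ι → S => ∏ k, p (b k)) * swapMatrix S M j) * swapMatrix S M i) =
      diagonal p ⊗ₖ trLeft A := by
  rw [swapMatrix_mul_mul, swapMatrix_mul_mul]
  ext ⟨s, m⟩ ⟨s', m'⟩
  simp only [trRight, Matrix.of_apply, Matrix.submatrix_apply, siteSwap_apply,
    Matrix.kronecker_apply]
  by_cases hs : s = s'
  · subst hs
    simp only [Matrix.diagonal_apply_eq, trLeft, Matrix.of_apply]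
    rw [← sum_mul_prod_erase p hp (fun x => A (x, m) (x, m')) j, Finset.mul_sum]
    refine Finset.sum_congr rfl fun b _ => ?_
    have hi : i ∈ Finset.univ.erase j := Finset.mem_erase.mpr ⟨hij, Finset.mem_univ i⟩
    rw [← Finset.mul_prod_erase _ _ (Finset.mem_univ j), Function.update_self,
      ← Finset.mul_prod_erase _ _ hi, ← Finset.mul_prod_erase _ (fun k => p (b k)) hi,
      Function.update_of_ne hij, Function.update_self, Function.update_of_ne hij.symm]
    have : ∏ k ∈ (Finset.univ.erase j).erase i,
        p (Function.update (Function.update b i s) j (b i) k) =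
        ∏ k ∈ (Finset.univ.erase j).erase i, p (b k) :=
      Finset.prod_congr rfl fun k hk => by
        rw [Function.update_of_ne (Finset.ne_of_mem_erase (Finset.mem_of_mem_erase hk)),
          Function.update_of_ne (Finset.ne_of_mem_erase hk)]
    rw [this]; ring
  · have : ∀ b : ι → S, Function.update (Function.update b i s) j (b i) ≠
        Function.update (Function.update b i s') j (b i) := fun b h =>
      hs (by simpa [hij] using congrFun h i)
    simp only [Matrix.diagonal_apply_ne _ (this _), Matrix.diagonal_apply_ne _ hs, mul_zero,
      zero_mul, Finset.sum_const_zero]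

/-- A bath of copies of `S`, whose sites can be exchanged with `S` by energy-preserving
involutions. -/
theorem exists_swap_bath (ι : Type*) [Fintype ι] [DecidableEq ι] [Nonempty S] (β : ℝ)
    {HS : Matrix S S ℂ} (hHS : HS.IsHermitian) (HM : Matrix M M ℂ) :
    ∃ (HB : Matrix (ι → S) (ι → S) ℂ)
      (F : ι → Matrix ((S × M) × (ι → S)) ((S × M) × (ι → S)) ℂ),
      HB.IsHermitian ∧ (gibbs β HB).PosSemidef ∧ (gibbs β HB).trace = 1 ∧
      (∀ j, (F j)ᴴ = F j) ∧ (∀ j, F j * F j = 1) ∧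
      (∀ j, Commute (F j) (totalHam (totalHam HS HM) HB)) ∧
      (∀ j A, trRight (F j * (A ⊗ₖ gibbs β HB) * F j) = gibbs β HS ⊗ₖ trLeft A) ∧
      (∀ i j A, i ≠ j → trRight (F i * (F j * (A ⊗ₖ gibbs β HB) * F j) * F i) =
        gibbs β HS ⊗ₖ trLeft A) := by
  set E := hHS.eigenvalues
  set V : Matrix S S ℂ := (hHS.eigenvectorUnitary : Matrix S S ℂ)
  have hV : Vᴴ * V = 1 := Unitary.coe_star_mul_self hHS.eigenvectorUnitary
  have hV' : V * Vᴴ = 1 := Unitary.coe_mul_star_self hHS.eigenvectorUnitary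
  have hspec : HS = V * (diagonal fun s => (E s : ℂ)) * Vᴴ := by
    have := hHS.spectral_theorem
    rw [Unitary.conjStarAlgAut_apply] at this
    exact this
  set p : S → ℂ := fun s => (boltzmann β E s : ℂ) with hp
  have hp1 : ∑ s, p s = 1 := by
    simp only [hp]; rw [← Complex.ofReal_sum, sum_boltzmann, Complex.ofReal_one]
  have hgS : gibbs β HS = V * diagonal p * Vᴴ := by
    rw [hspec, gibbs_conj β _ hV, gibbs_diagonal]
  set HB : Matrix (ι → S) (ι → S) ℂ := diagonal fun b => ∑ k, (E (b k) : ℂ) with hHB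
  have hHBh : HB.IsHermitian := by
    rw [hHB]
    refine Matrix.isHermitian_diagonal_of_self_adjoint _ ?_
    funext b
    simp
  have hgB : gibbs β HB = diagonal fun b : ι → S => ∏ k, p (b k) := by
    have : HB = diagonal fun b : ι → S => ((∑ k, E (b k) : ℝ) : ℂ) := by
      rw [hHB]; congr 1; funext b; push_cast; rfl
    rw [this, gibbs_diagonal β (fun b : ι → S => ∑ k, E (b k))]
    congr 1; funext b
    rw [boltzmann_pi]; push_cast; rfl
  set V1 : Matrix (S × M) (S × M) ℂ := V ⊗ₖ (1 : Matrix M M ℂ) with hV1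
  set V2 : Matrix ((S × M) × (ι → S)) ((S × M) × (ι → S)) ℂ :=
    V1 ⊗ₖ (1 : Matrix (ι → S) (ι → S) ℂ) with hV2
  have hV1a : V1ᴴ * V1 = 1 := by
    rw [hV1, Matrix.conjTranspose_kronecker, Matrix.conjTranspose_one, ← Matrix.mul_kronecker_mul,
      hV, Matrix.one_mul, Matrix.one_kronecker_one]
  have hV2a : V2ᴴ * V2 = 1 := by
    rw [hV2, Matrix.conjTranspose_kronecker, Matrix.conjTranspose_one, ← Matrix.mul_kronecker_mul,
      hV1a, Matrix.one_mul, Matrix.one_kronecker_one]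
  have hV2b : V2 * V2ᴴ = 1 := mul_eq_one_comm.mp hV2a
  have hV2h : V2ᴴ = V1ᴴ ⊗ₖ (1 : Matrix (ι → S) (ι → S) ℂ) := by
    rw [hV2, Matrix.conjTranspose_kronecker, Matrix.conjTranspose_one]
  have hham : totalHam (totalHam HS HM) HB =
      V2 * totalHam (totalHam (diagonal fun s => (E s : ℂ)) HM) HB * V2ᴴ := by
    conv_lhs => rw [hspec, totalHam_conj hV', totalHam_conj (mul_eq_one_comm.mp hV1a)]
  have hkron : ∀ A : Matrix (S × M) (S × M) ℂ,
      V2ᴴ * (A ⊗ₖ gibbs β HB) * V2 = (V1ᴴ * A * V1) ⊗ₖ gibbs β HB := by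
    intro A
    rw [hV2h, hV2]
    simp only [← Matrix.mul_kronecker_mul, Matrix.mul_one, Matrix.one_mul]
  have htr : ∀ A : Matrix ((S × M) × (ι → S)) ((S × M) × (ι → S)) ℂ,
      trRight (V2 * A * V2ᴴ) = V1 * trRight A * V1ᴴ := by
    intro A
    rw [hV2h, trRight_mul_kronecker_one, hV2, trRight_kronecker_one_mul]
  have hfin : ∀ A : Matrix (S × M) (S × M) ℂ,
      V1 * (diagonal p ⊗ₖ trLeft (V1ᴴ * A * V1)) * V1ᴴ = gibbs β HS ⊗ₖ trLeft A := by
    intro A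
    rw [hV1, trLeft_conj V hV', Matrix.conjTranspose_kronecker, Matrix.conjTranspose_one, hgS]
    simp only [← Matrix.mul_kronecker_mul, Matrix.mul_one, Matrix.one_mul]
  have hconj : ∀ A B : Matrix ((S × M) × (ι → S)) ((S × M) × (ι → S)) ℂ,
      (V2 * A * V2ᴴ) * (V2 * B * V2ᴴ) = V2 * (A * B) * V2ᴴ := by
    intro A B
    calc (V2 * A * V2ᴴ) * (V2 * B * V2ᴴ) = V2 * A * (V2ᴴ * V2) * B * V2ᴴ := by
          simp only [Matrix.mul_assoc]
      _ = _ := by rw [hV2a, Matrix.mul_one]; simp only [Matrix.mul_assoc]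
  have hkron' : ∀ A : Matrix (S × M) (S × M) ℂ,
      A ⊗ₖ gibbs β HB = V2 * ((V1ᴴ * A * V1) ⊗ₖ gibbs β HB) * V2ᴴ := by
    intro A
    calc A ⊗ₖ gibbs β HB = (V2 * V2ᴴ) * (A ⊗ₖ gibbs β HB) * (V2 * V2ᴴ) := by
          rw [hV2b, Matrix.one_mul, Matrix.mul_one]
      _ = V2 * (V2ᴴ * (A ⊗ₖ gibbs β HB) * V2) * V2ᴴ := by simp only [Matrix.mul_assoc]
      _ = _ := by rw [hkron]
  -- The eigenbasis rotation V acts on S only: the sites already use energy eigenbasis labels, as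
  -- the bath Hamiltonian is diagonal. Conjugating by V2 thus reduces everything to a diagonal H_S.
  refine ⟨HB, fun j => V2 * swapMatrix S M j * V2ᴴ, ?_, ?_, ?_, ?_, ?_, ?_, ?_, ?_⟩
  · exact hHBh
  · exact posSemidef_gibbs β hHBh
  · rw [hgB, Matrix.trace_diagonal, ← Fintype.piFinset_univ,
      ← Finset.prod_univ_sum (fun _ : ι => (Finset.univ : Finset S)) fun _ => p]
    exact Finset.prod_eq_one fun _ _ => hp1
  · intro j
    simp only [Matrix.conjTranspose_mul, Matrix.conjTranspose_conjTranspose,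
      swapMatrix_conjTranspose, Matrix.mul_assoc]
  · intro j
    change (V2 * swapMatrix S M j * V2ᴴ) * (V2 * swapMatrix S M j * V2ᴴ) = 1
    rw [hconj, swapMatrix_mul_self, Matrix.mul_one, hV2b]
  · intro j
    change _ * _ = _ * _
    rw [hham, hconj, hconj, (swapMatrix_commute (fun s => (E s : ℂ)) HM j).eq]
  · intro j A
    change trRight ((V2 * swapMatrix S M j * V2ᴴ) * _ * (V2 * swapMatrix S M j * V2ᴴ)) = _
    rw [hkron', hconj, hconj, htr, hgB, trRight_swap p hp1, hfin]
  · intro i j A hij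
    change trRight ((V2 * swapMatrix S M i * V2ᴴ) * ((V2 * swapMatrix S M j * V2ᴴ) * _ *
      (V2 * swapMatrix S M j * V2ᴴ)) * (V2 * swapMatrix S M i * V2ᴴ)) = _
    rw [hkron', hconj, hconj, hconj, hconj, htr, hgB, trRight_swap_swap p hp1 hij, hfin]

end SwapBath

end ThermalErasure

namespace ThermalErasure

noncomputable section

/-! ### Fidelity of two processes through their purifications. -/

theorem ofReal_sqrt_mul_self {c : ℝ} (hc : 0 ≤ c) :
    (Real.sqrt c : ℂ) * (Real.sqrt c : ℂ) = c := by
  rw [← Complex.ofReal_mul, Real.mul_self_sqrt hc]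

section Fidelity

variable {X B R κ : Type*} [Fintype B]

/-- The block of `|ψ⟩⟨ψ|` at the position `(r, r')` of the reference system. -/
def stateBlock (ψ : X × R → ℂ) (r r' : R) : Matrix X X ℂ :=
  Matrix.of fun x x' => pureState ψ (x, r) (x', r')

/-- The column at `r` of the purification of `|ψ⟩⟨ψ| ⊗ G G†`. -/
def purifiedBlock (ψ : X × R → ℂ) (G : Matrix B B ℂ) (r : R) : Matrix (X × B) B ℂ :=
  Matrix.of fun z b' => ψ (z.1, r) * G z.2 b'

theorem purifiedBlock_mul_conjTranspose (ψ : X × R → ℂ) (G : Matrix B B ℂ) (r r' : R) :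
    purifiedBlock ψ G r * (purifiedBlock ψ G r')ᴴ = stateBlock ψ r r' ⊗ₖ (G * Gᴴ) := by
  ext ⟨x, b⟩ ⟨x', b'⟩
  simp only [Matrix.mul_apply, purifiedBlock, Matrix.of_apply, Matrix.conjTranspose_apply,
    Matrix.kronecker_apply, stateBlock, pureState, Matrix.vecMulVec_apply, Pi.star_apply, star_mul,
    Finset.mul_sum]
  exact Finset.sum_congr rfl fun _ _ => by ring

variable [Fintype X]

/-- A purification of the output of `bathProcess`. -/
def purifiedProcess (c : ℝ) (ψ : X × R → ℂ) (G : Matrix B B ℂ)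
    (L : κ → Matrix (X × B) (X × B) ℂ) : Matrix (X × R) (κ × B × B) ℂ :=
  Matrix.of fun i k => (Real.sqrt c : ℂ) * (L k.1 * purifiedBlock ψ G i.2) (i.1, k.2.1) k.2.2

variable [Fintype κ]

/-- The completely positive map `A ↦ c ∑ₖ tr_B[Lₖ (A ⊗ Γ) Lₖ†]`. -/
def bathProcess (c : ℝ) (Γ : Matrix B B ℂ) (L : κ → Matrix (X × B) (X × B) ℂ)
    (A : Matrix X X ℂ) : Matrix X X ℂ :=
  (c : ℂ) • ∑ k, trRight (L k * (A ⊗ₖ Γ) * (L k)ᴴ)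

theorem purifiedProcess_mul_conjTranspose {c : ℝ} (hc : 0 ≤ c) (ψ : X × R → ℂ)
    (G : Matrix B B ℂ) (L : κ → Matrix (X × B) (X × B) ℂ) (i j : X × R) :
    (purifiedProcess c ψ G L * (purifiedProcess c ψ G L)ᴴ) i j =
      bathProcess c (G * Gᴴ) L (stateBlock ψ i.2 j.2) i.1 j.1 := by
  have h : ∀ k, L k * (stateBlock ψ i.2 j.2 ⊗ₖ (G * Gᴴ)) * (L k)ᴴ =
      (L k * purifiedBlock ψ G i.2) * (L k * purifiedBlock ψ G j.2)ᴴ := fun k => by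
    rw [← purifiedBlock_mul_conjTranspose, Matrix.conjTranspose_mul]
    simp only [Matrix.mul_assoc]
  unfold bathProcess
  simp only [h]
  simp only [Matrix.smul_apply, Matrix.sum_apply, trRight, Matrix.of_apply, smul_eq_mul]
  rw [Matrix.mul_apply]
  simp only [Fintype.sum_prod_type, Finset.mul_sum]
  refine Finset.sum_congr rfl fun k _ => Finset.sum_congr rfl fun b _ => ?_
  rw [Matrix.mul_apply, Finset.mul_sum]
  refine Finset.sum_congr rfl fun b' _ => ?_
  simp only [purifiedProcess, Matrix.conjTranspose_apply, Matrix.of_apply, star_mul']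
  rw [← ofReal_sqrt_mul_self hc]
  simp only [Complex.star_def, Complex.conj_ofReal]
  ring

variable [Fintype R]

/-- Tracing over R as well leaves only the reduced state of X, so the overlap of the purifications
is an expectation value in that state and Γ. -/
theorem trace_purifiedProcess {c : ℝ} (hc : 0 ≤ c) (ψ : X × R → ℂ)
    (G : Matrix B B ℂ) (L F : κ → Matrix (X × B) (X × B) ℂ) :
    ((purifiedProcess c ψ G L)ᴴ * purifiedProcess c ψ G F).trace =
      c * ∑ k, ((L k)ᴴ * F k * (trRight (pureState ψ) ⊗ₖ (G * Gᴴ))).trace := by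
  have hsum : trRight (pureState ψ) ⊗ₖ (G * Gᴴ) =
      ∑ r, purifiedBlock ψ G r * (purifiedBlock ψ G r)ᴴ := by
    simp only [purifiedBlock_mul_conjTranspose]
    ext ⟨x, b⟩ ⟨x', b'⟩
    simp [Matrix.sum_apply, trRight, stateBlock, Finset.sum_mul]
  have h : ∀ k, ((L k)ᴴ * F k * (trRight (pureState ψ) ⊗ₖ (G * Gᴴ))).trace =
      ∑ r, ((L k * purifiedBlock ψ G r)ᴴ * (F k * purifiedBlock ψ G r)).trace := fun k => by
    rw [hsum, Matrix.mul_sum, Matrix.trace_sum]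
    refine Finset.sum_congr rfl fun r _ => ?_
    rw [← Matrix.mul_assoc, Matrix.trace_mul_comm, Matrix.conjTranspose_mul]
    simp only [Matrix.mul_assoc]
  simp only [h]
  simp only [Matrix.trace, Matrix.diag_apply, Matrix.mul_apply (M := (_)ᴴ),
    Fintype.sum_prod_type, Finset.mul_sum]
  refine Finset.sum_congr rfl fun k _ => ?_
  rw [Finset.sum_comm]
  conv_rhs => rw [Finset.sum_comm]
  refine Finset.sum_congr rfl fun b' _ => ?_
  rw [Finset.sum_comm]
  conv_rhs => rw [Finset.sum_comm]
  refine Finset.sum_congr rfl fun x _ => ?_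
  rw [Finset.sum_comm]
  refine Finset.sum_congr rfl fun r _ => Finset.sum_congr rfl fun b _ => ?_
  simp only [purifiedProcess, Matrix.conjTranspose_apply, Matrix.of_apply, star_mul']
  rw [← ofReal_sqrt_mul_self hc]
  simp only [Complex.star_def, Complex.conj_ofReal]
  ring

/-- The fidelity of the outputs of two processes with the same bath is at least the overlap of
their canonical purifications. -/
theorem overlap_le_fidelity [DecidableEq X] [DecidableEq B] [DecidableEq R] [DecidableEq κ] {c : ℝ} (hc : 0 ≤ c) (ψ : X × R → ℂ) {Γ : Matrix B B ℂ}
    (hΓ : Γ.PosSemidef) (L F : κ → Matrix (X × B) (X × B) ℂ) {ρ σ : Matrix (X × R) (X × R) ℂ}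
    (hρ : ∀ i j, ρ i j = bathProcess c Γ L (stateBlock ψ i.2 j.2) i.1 j.1)
    (hσ : ∀ i j, σ i j = bathProcess c Γ F (stateBlock ψ i.2 j.2) i.1 j.1) :
    c * ∑ k, ((L k)ᴴ * F k * (trRight (pureState ψ) ⊗ₖ Γ)).trace.re ≤ fidelity ρ σ := by
  -- Any factorization Γ = G G† purifies the bath; the column index of G is the purifying system.
  obtain ⟨G', hG'⟩ := CStarAlgebra.nonneg_iff_eq_star_mul_self.mp hΓ.nonneg
  obtain ⟨G, rfl⟩ : ∃ G : Matrix B B ℂ, Γ = G * Gᴴ :=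
    ⟨G'ᴴ, by rw [Matrix.conjTranspose_conjTranspose]; exact hG'⟩
  have h := trace_conjTranspose_mul_re_le_fidelity (purifiedProcess c ψ G L)
    (purifiedProcess c ψ G F)
  rw [trace_purifiedProcess hc, Complex.re_ofReal_mul, Complex.re_sum] at h
  have e1 : purifiedProcess c ψ G L * (purifiedProcess c ψ G L)ᴴ = ρ := by
    ext i j; rw [hρ, purifiedProcess_mul_conjTranspose hc]
  have e2 : purifiedProcess c ψ G F * (purifiedProcess c ψ G F)ᴴ = σ := by
    ext i j; rw [hσ, purifiedProcess_mul_conjTranspose hc]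
  rwa [e1, e2] at h

end Fidelity

end

end ThermalErasure

namespace ThermalErasure

noncomputable section

/-! ### Thermal operations with an arbitrary finite bath index. -/

section ThermalMap

theorem exp_reindex {X Y : Type*} [Fintype X] [DecidableEq X] [Fintype Y] [DecidableEq Y]
    (e : X ≃ Y) (A : Matrix X X ℂ) :
    NormedSpace.exp (A.submatrix e.symm e.symm) = (NormedSpace.exp A).submatrix e.symm e.symm := by
  let : NormedRing (Matrix X X ℂ) := Matrix.linftyOpNormedRing
  let : NormedAlgebra ℂ (Matrix X X ℂ) := Matrix.linftyOpNormedAlgebra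
  let : NormedAlgebra ℚ (Matrix X X ℂ) := Matrix.linftyOpNormedAlgebra
  let : NormedRing (Matrix Y Y ℂ) := Matrix.linftyOpNormedRing
  exact (NormedSpace.map_exp (Matrix.reindexAlgEquiv ℂ ℂ e)
    (by exact Continuous.matrix_submatrix continuous_id _ _) A).symm

theorem gibbs_reindex {X Y : Type*} [Fintype X] [DecidableEq X] [Fintype Y] [DecidableEq Y]
    (e : X ≃ Y) (β : ℝ) (H : Matrix X X ℂ) :
    gibbs β (H.submatrix e.symm e.symm) = (gibbs β H).submatrix e.symm e.symm := by
  unfold gibbs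
  have h : (-β : ℂ) • H.submatrix e.symm e.symm = ((-β : ℂ) • H).submatrix e.symm e.symm := rfl
  rw [h, exp_reindex]
  have ht : ((NormedSpace.exp ((-β : ℂ) • H)).submatrix e.symm e.symm).trace =
      (NormedSpace.exp ((-β : ℂ) • H)).trace :=
    Equiv.sum_comp e.symm fun x => NormedSpace.exp ((-β : ℂ) • H) x x
  rw [ht]; rfl

/-- The map `A ↦ tr_B[U (A ⊗ Γ) U†]`. -/
def bathMap {X B : Type*} [Fintype X] [Fintype B] (Γ : Matrix B B ℂ)
    (U : Matrix (X × B) (X × B) ℂ) : Matrix X X ℂ →ₗ[ℂ] Matrix X X ℂ where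
  toFun A := trRight (U * (A ⊗ₖ Γ) * Uᴴ)
  map_add' A A' := by
    ext i j
    simp [trRight, Matrix.add_kronecker, Matrix.mul_add, Matrix.add_mul, Finset.sum_add_distrib]
  map_smul' c A := by
    ext i j
    simp [trRight, Matrix.smul_kronecker, Finset.mul_sum]

/-- The bath of a thermal operation may be indexed by any finite type. -/
theorem isThermalOperation_bathMap {X B : Type*} [Fintype X] [DecidableEq X] [Fintype B]
    [DecidableEq B] [Nonempty B] (β : ℝ) (H : Matrix X X ℂ) {HB : Matrix B B ℂ}
    (hHB : HB.IsHermitian) {U : Matrix (X × B) (X × B) ℂ} (hU : U * Uᴴ = 1)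
    (hc : Commute U (totalHam H HB)) : IsThermalOperation β H (bathMap (gibbs β HB) U) := by
  let e : B ≃ Fin (Fintype.card B) := Fintype.equivFin B
  let f : X × Fin (Fintype.card B) ≃ X × B := (Equiv.refl X).prodCongr e.symm
  have hham : totalHam H (HB.submatrix e.symm e.symm) = (totalHam H HB).submatrix f f := by
    ext ⟨x, i⟩ ⟨x', i'⟩
    simp [totalHam, f, Matrix.one_apply]
  refine ⟨Fintype.card B, Fintype.card_pos, HB.submatrix e.symm e.symm, hHB.submatrix _,
    U.submatrix f f, ?_, ?_, ?_⟩
  · rw [Matrix.mem_unitaryGroup_iff, star_eq_conjTranspose, Matrix.conjTranspose_submatrix,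
      Matrix.submatrix_mul_equiv, hU, Matrix.submatrix_one_equiv]
  · change _ * _ = _ * _
    rw [hham, Matrix.submatrix_mul_equiv, Matrix.submatrix_mul_equiv, hc.eq]
  · intro A
    have hk : A ⊗ₖ gibbs β (HB.submatrix e.symm e.symm) = (A ⊗ₖ gibbs β HB).submatrix f f := by
      rw [gibbs_reindex]; rfl
    rw [hk, Matrix.conjTranspose_submatrix, Matrix.submatrix_mul_equiv,
      Matrix.submatrix_mul_equiv]
    ext x x'
    exact (Equiv.sum_comp e.symm fun b => (U * (A ⊗ₖ gibbs β HB) * Uᴴ) (x, b) (x', b)).symm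

end ThermalMap

/-! ### From a complete family of operators to a thermal operation with a battery. -/

section Dilation

/-- The battery state on the span of the basis vectors in `s`. -/
def BatteryState.ofFinset {W : Type*} [Fintype W] [DecidableEq W] (s : Finset W)
    (hs : s.Nonempty) : BatteryState W where
  proj := diagonal fun i => if i ∈ s then 1 else 0
  isStarProjection := by
    constructor
    · change _ * _ = _
      rw [Matrix.diagonal_mul_diagonal]
      congr 1; funext i; split_ifs <;> simp
    · refine Matrix.isHermitian_diagonal_of_self_adjoint _ ?_
      funext i
      simp only [Pi.star_apply]
      split_ifs <;> simp
  proj_ne_zero := by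
    obtain ⟨i, hi⟩ := hs
    intro h
    have := congrFun (congrFun h i) i
    simp [hi] at this

theorem BatteryState.charge_ofFinset {W : Type*} [Fintype W] [DecidableEq W] (s : Finset W)
    (hs : s.Nonempty) :
    (BatteryState.ofFinset s hs).charge = Real.log (Fintype.card W) - Real.log s.card := by
  unfold BatteryState.charge BatteryState.ofFinset
  rw [Matrix.rank_diagonal]
  congr 3
  rw [Fintype.card_subtype]
  congr 1
  ext i
  simp

theorem BatteryState.state_ofFinset {W : Type*} [Fintype W] [DecidableEq W] (s : Finset W)
    (hs : s.Nonempty) : (BatteryState.ofFinset s hs).state =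
      diagonal fun i => if i ∈ s then (s.card : ℂ)⁻¹ else 0 := by
  unfold BatteryState.state BatteryState.ofFinset
  rw [Matrix.trace_diagonal, ← Matrix.diagonal_smul]
  congr 1
  funext i
  simp

variable {Z : Type*} [Fintype Z] {n : ℕ}

/-- The column of blocks `Lₖ†`. -/
def blockColumn (L : Fin n → Matrix Z Z ℂ) : Matrix (Z × Fin n) Z ℂ :=
  Matrix.of fun z z' => (L z.2)ᴴ z.1 z'

theorem blockColumn_conjTranspose_mul_mul (L : Fin n → Matrix Z Z ℂ) (A : Matrix Z Z ℂ) :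
    (blockColumn L)ᴴ * (A ⊗ₖ (1 : Matrix (Fin n) (Fin n) ℂ)) * blockColumn L =
      ∑ k, L k * A * (L k)ᴴ := by
  have h : (A ⊗ₖ (1 : Matrix (Fin n) (Fin n) ℂ)) * blockColumn L =
      Matrix.of fun z z' => (A * (L z.2)ᴴ) z.1 z' := by
    ext ⟨z, k⟩ z'
    simp [Matrix.mul_apply, Fintype.sum_prod_type, blockColumn, Matrix.one_apply]
  rw [Matrix.mul_assoc, h]
  ext z z'
  rw [Matrix.sum_apply]
  simp only [Matrix.mul_assoc]
  simp only [Matrix.mul_apply (N := Matrix.of _), Fintype.sum_prod_type_right]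
  refine Finset.sum_congr rfl fun k _ => ?_
  rw [Matrix.mul_apply]
  simp [blockColumn]

theorem blockColumn_mul_comm (L : Fin n → Matrix Z Z ℂ) {H : Matrix Z Z ℂ}
    (hL : ∀ k, (L k)ᴴ * H = H * (L k)ᴴ) :
    blockColumn L * H = (H ⊗ₖ (1 : Matrix (Fin n) (Fin n) ℂ)) * blockColumn L := by
  ext ⟨z, k⟩ z'
  have := congrFun (congrFun (hL k) z) z'
  simp only [Matrix.mul_apply] at this
  simp only [Matrix.mul_apply, Fintype.sum_prod_type, blockColumn, Matrix.of_apply,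
    Matrix.kronecker_apply, Matrix.one_apply]
  simpa using this

/-- A unitary involution whose off-diagonal block is a given isometry. -/
def isometryDilation {Z Y : Type*} [Fintype Z] [DecidableEq Z] [DecidableEq Y]
    (V : Matrix Y Z ℂ) : Matrix (Z ⊕ Y) (Z ⊕ Y) ℂ :=
  fromBlocks 0 Vᴴ V (1 - V * Vᴴ)

theorem isometryDilation_conjTranspose {Z Y : Type*} [Fintype Z] [DecidableEq Z] [DecidableEq Y]
    (V : Matrix Y Z ℂ) : (isometryDilation V)ᴴ = isometryDilation V := by
  simp [isometryDilation, Matrix.fromBlocks_conjTranspose]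

theorem isometryDilation_mul_self {Z Y : Type*} [Fintype Z] [DecidableEq Z] [Fintype Y]
    [DecidableEq Y] {V : Matrix Y Z ℂ} (hV : Vᴴ * V = 1) :
    isometryDilation V * isometryDilation V = 1 := by
  have h1 : Vᴴ * (1 - V * Vᴴ) = 0 := by
    rw [Matrix.mul_sub, ← Matrix.mul_assoc, hV]; simp
  have h2 : (1 - V * Vᴴ) * V = 0 := by
    rw [Matrix.sub_mul, Matrix.mul_assoc, hV]; simp
  have h3 : (1 - V * Vᴴ) * (1 - V * Vᴴ) = 1 - V * Vᴴ := by
    rw [Matrix.sub_mul, Matrix.one_mul, Matrix.mul_assoc V, h1]; simp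
  simp [isometryDilation, Matrix.fromBlocks_multiply, hV, h1, h2, h3]

theorem isometryDilation_commute {Z Y : Type*} [Fintype Z] [DecidableEq Z] [Fintype Y]
    [DecidableEq Y] {V : Matrix Y Z ℂ} {H : Matrix Z Z ℂ} {K : Matrix Y Y ℂ}
    (hH : H.IsHermitian) (hK : K.IsHermitian) (h : V * H = K * V) :
    Commute (isometryDilation V) (fromBlocks H 0 0 K) := by
  have h' : Vᴴ * K = H * Vᴴ := by
    have := congrArg Matrix.conjTranspose h
    rw [Matrix.conjTranspose_mul, Matrix.conjTranspose_mul, hH.eq, hK.eq] at this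
    exact this.symm
  have h3 : (1 - V * Vᴴ) * K = K * (1 - V * Vᴴ) := by
    rw [Matrix.sub_mul, Matrix.mul_sub, Matrix.mul_assoc, h', ← Matrix.mul_assoc, h]
    simp [Matrix.mul_assoc]
  change _ * _ = _ * _
  simp [isometryDilation, Matrix.fromBlocks_multiply, h, h', h3]

theorem isHermitian_totalHam {X Y : Type*} [DecidableEq X] [DecidableEq Y]
    {HX : Matrix X X ℂ} {HY : Matrix Y Y ℂ} (hX : HX.IsHermitian) (hY : HY.IsHermitian) :
    (totalHam HX HY).IsHermitian := by
  unfold totalHam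
  rw [Matrix.IsHermitian, Matrix.conjTranspose_add, Matrix.conjTranspose_kronecker,
    Matrix.conjTranspose_kronecker, Matrix.conjTranspose_one, Matrix.conjTranspose_one, hX.eq,
    hY.eq]

/-- The register of the battery: the value `0` is the target of the final battery state. -/
def registerEquiv (X B : Type*) (n : ℕ) : (X × B) ⊕ ((X × B) × Fin n) ≃ (X × Fin (n + 1)) × B where
  toFun := Sum.elim (fun z => ((z.1, 0), z.2)) (fun w => ((w.1.1, w.2.succ), w.1.2))
  invFun w := Fin.cases (Sum.inl (w.1.1, w.2)) (fun k => Sum.inr ((w.1.1, w.2), k)) w.1.2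
  left_inv := by rintro (⟨x, b⟩ | ⟨⟨x, b⟩, k⟩) <;> simp
  right_inv := by
    rintro ⟨⟨x, i⟩, b⟩
    refine Fin.cases ?_ (fun k => ?_) i <;> simp

/-- Every complete family of energy-preserving operators `Lₖ` on system and bath is implemented,
with uniform weights, by a thermal operation on system and battery with work gain `log n`. -/
theorem exists_thermalOperation_of_row {X B : Type*} [Fintype X] [DecidableEq X] [Fintype B]
    [DecidableEq B] [Nonempty B] (β : ℝ) {H : Matrix X X ℂ} (hH : H.IsHermitian)
    {HB : Matrix B B ℂ} (hHB : HB.IsHermitian) (hn : 0 < n)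
    (L : Fin n → Matrix (X × B) (X × B) ℂ) (hL : ∑ k, L k * (L k)ᴴ = 1)
    (hc : ∀ k, Commute (L k) (totalHam H HB)) :
    ∃ (τ τ' : BatteryState (Fin (n + 1)))
      (Φ : Matrix (X × Fin (n + 1)) (X × Fin (n + 1)) ℂ →ₗ[ℂ]
        Matrix (X × Fin (n + 1)) (X × Fin (n + 1)) ℂ),
      IsThermalOperation β (totalHam H (0 : Matrix (Fin (n + 1)) (Fin (n + 1)) ℂ)) Φ ∧
      (∀ A, effectiveWorkProcess Φ τ τ' A = bathProcess (n : ℝ)⁻¹ (gibbs β HB) L A) ∧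
      τ.charge - τ'.charge = -Real.log n := by
  -- The battery starts uniform on the n nonzero values of a register of n + 1 values and ends at 0.
  -- The charges are ln(n + 1) - ln n and ln(n + 1), so their difference is -ln n.
  have hs : (Finset.univ.erase (0 : Fin (n + 1))).Nonempty := ⟨Fin.succ ⟨0, hn⟩, by simp⟩
  set e := registerEquiv X B n with he
  set V := blockColumn L with hVdef
  set T := totalHam H HB with hT
  have hTh : T.IsHermitian := isHermitian_totalHam hH hHB
  have hV : Vᴴ * V = 1 := by
    have := blockColumn_conjTranspose_mul_mul L 1
    rw [Matrix.one_kronecker_one, Matrix.mul_one] at this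
    rw [this]
    simpa only [Matrix.mul_one] using hL
  have hVT : V * T = (T ⊗ₖ (1 : Matrix (Fin n) (Fin n) ℂ)) * V := by
    refine blockColumn_mul_comm L fun k => ?_
    have := congrArg Matrix.conjTranspose (hc k).eq
    rw [Matrix.conjTranspose_mul, Matrix.conjTranspose_mul, hTh.eq] at this
    exact this.symm
  have hTk : (T ⊗ₖ (1 : Matrix (Fin n) (Fin n) ℂ)).IsHermitian := by
    rw [Matrix.IsHermitian, Matrix.conjTranspose_kronecker, hTh.eq, Matrix.conjTranspose_one]
  -- The battery has zero Hamiltonian, so the energy is a copy of T for every register value;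
  -- unitaries may therefore mix register values freely as long as their blocks respect T.
  have hham : totalHam (totalHam H (0 : Matrix (Fin (n + 1)) (Fin (n + 1)) ℂ)) HB =
      (fromBlocks T 0 0 (T ⊗ₖ (1 : Matrix (Fin n) (Fin n) ℂ))).submatrix e.symm e.symm := by
    have h : (totalHam (totalHam H (0 : Matrix (Fin (n + 1)) (Fin (n + 1)) ℂ)) HB).submatrix e e =
        fromBlocks T 0 0 (T ⊗ₖ (1 : Matrix (Fin n) (Fin n) ℂ)) := by
      ext (⟨x, b⟩ | ⟨⟨x, b⟩, k⟩) (⟨x', b'⟩ | ⟨⟨x', b'⟩, k'⟩)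
      · simp [he, registerEquiv, hT, totalHam, Matrix.one_apply]
      · simp [he, registerEquiv, totalHam, Matrix.one_apply, (Fin.succ_ne_zero k').symm]
      · simp [he, registerEquiv, totalHam, Matrix.one_apply]
      · by_cases hk : k = k'
        · simp [he, registerEquiv, hT, totalHam, Matrix.one_apply, hk]
        · simp [he, registerEquiv, hT, totalHam, hk]
    rw [← h]; simp
  set U := (isometryDilation V).submatrix e.symm e.symm with hU
  have hUh : Uᴴ = U := by
    rw [hU, Matrix.conjTranspose_submatrix, isometryDilation_conjTranspose]
  have hstate : ∀ A : Matrix X X ℂ, ∀ G : Matrix B B ℂ,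
      (A ⊗ₖ (BatteryState.ofFinset _ hs).state) ⊗ₖ G =
      (fromBlocks 0 0 0 (((n : ℂ)⁻¹ • (A ⊗ₖ G)) ⊗ₖ
        (1 : Matrix (Fin n) (Fin n) ℂ))).submatrix e.symm e.symm := by
    intro A G
    rw [BatteryState.state_ofFinset]
    have h : ((A ⊗ₖ (diagonal fun i : Fin (n + 1) => if i ∈ Finset.univ.erase 0 then
          (((Finset.univ.erase (0 : Fin (n + 1))).card : ℂ))⁻¹ else 0)) ⊗ₖ G).submatrix e e =
        fromBlocks 0 0 0 (((n : ℂ)⁻¹ • (A ⊗ₖ G)) ⊗ₖ (1 : Matrix (Fin n) (Fin n) ℂ)) := by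
      ext (⟨x, b⟩ | ⟨⟨x, b⟩, k⟩) (⟨x', b'⟩ | ⟨⟨x', b'⟩, k'⟩)
      · simp [he, registerEquiv]
      · simp [he, registerEquiv, (Fin.succ_ne_zero k').symm]
      · simp [he, registerEquiv]
      · by_cases hk : k = k'
        · simp [he, registerEquiv, hk]; ring
        · simp [he, registerEquiv, hk]
    rw [← h]; simp
  refine ⟨BatteryState.ofFinset _ hs,
    BatteryState.ofFinset {0} (Finset.singleton_nonempty _), bathMap (gibbs β HB) U, ?_, ?_, ?_⟩
  · refine isThermalOperation_bathMap β _ hHB ?_ ?_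
    · rw [hUh, hU, Matrix.submatrix_mul_equiv, isometryDilation_mul_self hV,
        Matrix.submatrix_one_equiv]
    · change _ * _ = _ * _
      rw [hham, hU, Matrix.submatrix_mul_equiv, Matrix.submatrix_mul_equiv,
        (isometryDilation_commute hTh hTk hVT).eq]
  · intro A
    ext x x'
    have h1 : U * ((A ⊗ₖ (BatteryState.ofFinset _ hs).state) ⊗ₖ gibbs β HB) * Uᴴ =
        (isometryDilation V * fromBlocks 0 0 0 (((n : ℂ)⁻¹ • (A ⊗ₖ gibbs β HB)) ⊗ₖ
          (1 : Matrix (Fin n) (Fin n) ℂ)) * isometryDilation V).submatrix e.symm e.symm := by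
      rw [hUh, hstate, hU, Matrix.submatrix_mul_equiv, Matrix.submatrix_mul_equiv]
    have h2 : ∀ z z', (isometryDilation V * fromBlocks 0 0 0 (((n : ℂ)⁻¹ • (A ⊗ₖ gibbs β HB)) ⊗ₖ
          (1 : Matrix (Fin n) (Fin n) ℂ)) * isometryDilation V :
          Matrix ((X × B) ⊕ ((X × B) × Fin n)) ((X × B) ⊕ ((X × B) × Fin n)) ℂ)
          (Sum.inl z) (Sum.inl z') =
        (n : ℂ)⁻¹ * (∑ k, L k * (A ⊗ₖ gibbs β HB) * (L k)ᴴ) z z' := by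
      intro z z'
      rw [isometryDilation, Matrix.fromBlocks_multiply, Matrix.fromBlocks_multiply,
        Matrix.fromBlocks_apply₁₁]
      simp only [Matrix.mul_zero, zero_add, add_zero]
      rw [hVdef, blockColumn_conjTranspose_mul_mul]
      simp only [Matrix.mul_smul, Matrix.smul_mul]
      rw [← Finset.smul_sum, Matrix.smul_apply, smul_eq_mul]
    have h3 : ∀ Y : Matrix (X × Fin (n + 1)) (X × Fin (n + 1)) ℂ,
        trRight (((1 : Matrix X X ℂ) ⊗ₖ (BatteryState.ofFinset {(0 : Fin (n + 1))}
          (Finset.singleton_nonempty _)).proj) * Y) x x' = Y (x, 0) (x', 0) := by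
      intro Y
      simp [trRight, BatteryState.ofFinset, Matrix.mul_apply, Fintype.sum_prod_type,
        Matrix.one_apply, Matrix.diagonal_apply]
    refine (h3 _).trans ?_
    change ∑ b, (U * ((A ⊗ₖ (BatteryState.ofFinset _ hs).state) ⊗ₖ gibbs β HB) * Uᴴ :
      Matrix ((X × Fin (n + 1)) × B) ((X × Fin (n + 1)) × B) ℂ) ((x, 0), b) ((x', 0), b) = _
    rw [h1]
    simp only [bathProcess, Matrix.smul_apply, Matrix.sum_apply, trRight, Matrix.of_apply,
      smul_eq_mul]
    rw [Finset.sum_comm, Finset.mul_sum]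
    refine Finset.sum_congr rfl fun b _ => ?_
    refine (h2 (x, b) (x', b)).trans ?_
    rw [Matrix.sum_apply]
    push_cast; rfl
  · rw [BatteryState.charge_ofFinset, BatteryState.charge_ofFinset]
    simp

end Dilation

end

end ThermalErasure

namespace ThermalErasure

/-! ### Sequential decoding of the position. -/

section Decoding

variable {Z : Type*} [Fintype Z] [DecidableEq Z]

/-- The product `A (k - 1) * ⋯ * A 0`. -/
def chain (A : ℕ → Matrix Z Z ℂ) : ℕ → Matrix Z Z ℂ
  | 0 => 1
  | k + 1 => A k * chain A k

theorem chain_congr {A A' : ℕ → Matrix Z Z ℂ} {n : ℕ} (h : ∀ k < n, A k = A' k) :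
    chain A n = chain A' n := by
  induction n with
  | zero => rfl
  | succ n ih => rw [chain, chain, h n (by omega), ih fun k hk => h k (by omega)]

theorem commute_chain {A : ℕ → Matrix Z Z ℂ} {T : Matrix Z Z ℂ} (h : ∀ k, Commute (A k) T) (n : ℕ) :
    Commute (chain A n) T := by
  induction n with
  | zero => exact Commute.one_left T
  | succ n ih => exact (h n).mul_left ih

/-- Energy conservation passes to the adjoints, from which the decoding operators are built. -/
theorem commute_conjTranspose {Z : Type*} [Fintype Z] {A T : Matrix Z Z ℂ} (hT : T.IsHermitian) (h : Commute A T) :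
    Commute Aᴴ T := by
  have := congrArg Matrix.conjTranspose h.eq
  rw [Matrix.conjTranspose_mul, Matrix.conjTranspose_mul, hT.eq] at this
  exact this.symm

/-- If every step of a sequential measurement is complete, then so is the whole measurement, up
to the event that no outcome occurs. -/
theorem sum_chain_mul (A : ℕ → Matrix Z Z ℂ) (E : ℕ → Matrix Z Z ℂ)
    (h : ∀ k, E k * (E k)ᴴ + (A k)ᴴ * A k = 1) (n : ℕ) :
    ∑ k ∈ Finset.range n, ((chain A k)ᴴ * E k) * ((chain A k)ᴴ * E k)ᴴ =
      1 - (chain A n)ᴴ * chain A n := by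
  induction n with
  | zero => simp [chain]
  | succ n ih =>
    rw [Finset.sum_range_succ, ih, chain, Matrix.conjTranspose_mul, Matrix.conjTranspose_mul,
      Matrix.conjTranspose_conjTranspose]
    have : (chain A n)ᴴ * E n * ((E n)ᴴ * chain A n) =
        (chain A n)ᴴ * (1 - (A n)ᴴ * A n) * chain A n := by
      rw [← h n, add_sub_cancel_right]; simp only [Matrix.mul_assoc]
    rw [this]; noncomm_ring

/-- Sequential decoding of the position `k` from the states `F k * Y * F k`. -/
theorem exists_decoding_row {T : Matrix Z Z ℂ} (hT : T.IsHermitian) (N : ℕ)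
    (F : Fin (N + 1) → Matrix Z Z ℂ) (hFh : ∀ k, (F k)ᴴ = F k) (hFF : ∀ k, F k * F k = 1)
    (hFT : ∀ k, Commute (F k) T) {Q Y : Matrix Z Z ℂ} (hQ : Q.PosSemidef)
    (hQ1 : (1 - Q).PosSemidef) (hQT : Commute Q T) (hY : Y.PosSemidef) (hY1 : Y.trace = 1)
    {ε δ : ℝ} (hδ : 0 ≤ δ) (hε : 0 ≤ ε) (hQY : ((1 - Q) * Y).trace.re ≤ ε)
    (hQF : ∀ i j, i ≠ j → (Q * (F i * (F j * Y * F j) * F i)).trace.re ≤ δ) :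
    ∃ L : Fin (N + 1) → Matrix Z Z ℂ, ∑ k, L k * (L k)ᴴ = 1 ∧ (∀ k, Commute (L k) T) ∧
      ∀ k, 1 - 2 * (N * δ + ε) ≤ ((L k)ᴴ * F k * Y).trace.re := by
  obtain ⟨B, hB, hB1, hBB, hBQ, hBc⟩ := exists_sqrt_effect hQ hQ1
  obtain ⟨C, hC, hC1, hCC, hCQ, hCc⟩ := exists_sqrt_effect hQ1 (by simpa using hQ)
  have hBT := hBc T hQT
  have hCT := hCc T ((Commute.one_left T).sub_left hQT)
  have hconj1 : ∀ k, ∀ G : Matrix Z Z ℂ, (1 - G).PosSemidef → (1 - F k * G * F k).PosSemidef := by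
    intro k G hG
    have := hG.mul_mul_conjTranspose_same (F k)
    rwa [hFh, Matrix.mul_sub, Matrix.sub_mul, Matrix.mul_one, hFF] at this
  have hconj : ∀ k, ∀ G : Matrix Z Z ℂ, G.PosSemidef → (F k * G * F k).PosSemidef := by
    intro k G hG
    have := hG.mul_mul_conjTranspose_same (F k)
    rwa [hFh] at this
  have hFTF : ∀ k, ∀ G : Matrix Z Z ℂ, Commute G T → Commute (F k * G * F k) T := fun k G hG =>
    ((hFT k).mul_left hG).mul_left (hFT k)
  let f : ℕ → Fin (N + 1) := Fin.ofNat (N + 1)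
  have hf : ∀ k : Fin (N + 1), f k = k := fun k => by simp [f]
  have hfne : ∀ i < N + 1, ∀ j < N + 1, i ≠ j → f i ≠ f j := by
    intro i hi j hj hij h
    apply hij
    have := congrArg Fin.val h
    simpa [f, Fin.ofNat, Nat.mod_eq_of_lt hi, Nat.mod_eq_of_lt hj] using this
  -- Amplitudes for rejecting (A, from C = √(1 - Q)) and accepting (b, from B = √Q) a position. The
  -- last position N is always accepted, so some outcome always occurs and the family is complete
  -- without a failure operator.
  let A : ℕ → Matrix Z Z ℂ := fun k => if k = N then 0 else F (f k) * C * F (f k)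
  let b : ℕ → Matrix Z Z ℂ := fun k => if k = N then 1 else B
  have hAh : ∀ k, (A k)ᴴ = A k := fun k => by
    simp only [A]; split_ifs
    · simp
    · exact (hconj _ _ hC).isHermitian.eq
  have hbpos : ∀ k, (b k).PosSemidef := fun k => by
    simp only [b]; split_ifs
    · exact Matrix.PosSemidef.one
    · exact hB
  have hb1 : ∀ k, (1 - b k).PosSemidef := fun k => by
    simp only [b]; split_ifs
    · simpa using Matrix.PosSemidef.zero
    · exact hB1
  have hbh : ∀ k, (b k)ᴴ = b k := fun k => (hbpos k).isHermitian.eq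
  have hAT : ∀ k, Commute (A k) T := fun k => by
    simp only [A]; split_ifs
    · exact Commute.zero_left T
    · exact hFTF _ _ hCT
  have hbT : ∀ k, Commute (b k) T := fun k => by
    simp only [b]; split_ifs
    · exact Commute.one_left T
    · exact hBT
  have hcomplete : ∀ k, (F (f k) * b k) * (F (f k) * b k)ᴴ + (A k)ᴴ * A k = 1 := fun k => by
    rw [Matrix.conjTranspose_mul, hbh, hFh, hAh]
    have e1 : F (f k) * b k * (b k * F (f k)) = F (f k) * (b k * b k) * F (f k) := by
      simp only [Matrix.mul_assoc]
    rw [e1]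
    simp only [A, b]
    split_ifs
    · simp [hFF]
    · have e2 : F (f k) * C * F (f k) * (F (f k) * C * F (f k)) =
          F (f k) * (C * C) * F (f k) := by
        calc _ = F (f k) * C * (F (f k) * F (f k)) * C * F (f k) := by
              simp only [Matrix.mul_assoc]
          _ = _ := by rw [hFF, Matrix.mul_one]; simp only [Matrix.mul_assoc]
      rw [e2, hBB, hCC, ← Matrix.add_mul, ← Matrix.mul_add, add_sub_cancel, Matrix.mul_one, hFF]
  -- L_k† rejects all positions before k, exchanges S with copy k and applies the accepting
  -- amplitude.
  refine ⟨fun k => (chain A k)ᴴ * (F k * b k), ?_, ?_, ?_⟩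
  · have h := sum_chain_mul A (fun k => F (f k) * b k) hcomplete (N + 1)
    have h0 : chain A (N + 1) = 0 := by rw [chain]; simp [A]
    rw [h0, Matrix.mul_zero, sub_zero, Finset.sum_range] at h
    simpa only [hf] using h
  · intro k
    exact (commute_conjTranspose hT (commute_chain hAT k)).mul_left ((hFT k).mul_left (hbT k))
  · intro k
    have hkN : (k : ℕ) < N + 1 := k.2
    set ω := F k * Y * F k with hω
    have hωpos : ω.PosSemidef := hconj _ _ hY
    have hω1 : ω.trace = 1 := by
      rw [hω, Matrix.trace_mul_comm, ← Matrix.mul_assoc, hFF, Matrix.one_mul, hY1]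
    -- The same sequence with its k-th step replaced by acceptance at k. In the state ω with true
    -- position k every step nearly holds, so the sequential bound applies.
    let A' : ℕ → Matrix Z Z ℂ := fun i => if i = (k : ℕ) then F k * b k * F k else A i
    have hchain : chain A' (k + 1) = F k * b k * F k * chain A k := by
      rw [chain]
      congr 1
      · simp [A']
      · exact chain_congr fun i hi => by simp [A', hi.ne]
    have hA'lt : ∀ i < (k : ℕ), A' i = F (f i) * C * F (f i) := fun i hi => by
      have h1 : i ≠ (k : ℕ) := hi.ne
      have h2 : i ≠ N := by omega
      simp [A', A, h1, h2]
    have hA'k : A' k = F k * b k * F k := by simp [A']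
    have hub := one_sub_trace_le_of_sequence hωpos hω1 A' (chain A') rfl (fun _ => rfl) (k + 1)
      (fun i hi => by
        rcases Nat.lt_succ_iff_lt_or_eq.mp hi with h | h
        · rw [hA'lt i h]; exact hconj _ _ hC
        · rw [h, hA'k]; exact hconj _ _ (hbpos _))
      (fun i hi => by
        rcases Nat.lt_succ_iff_lt_or_eq.mp hi with h | h
        · rw [hA'lt i h]; exact hconj1 _ _ hC1
        · rw [h, hA'k]; exact hconj1 _ _ (hb1 _))
    have hcyc : ∀ (j : Fin (N + 1)) (G W : Matrix Z Z ℂ),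
        ((1 - F j * G * F j) * W).trace = ((1 - G) * (F j * W * F j)).trace := by
      intro j G W
      have : 1 - F j * G * F j = F j * (1 - G) * F j := by
        rw [Matrix.mul_sub, Matrix.sub_mul, Matrix.mul_one, hFF]
      rw [this, Matrix.mul_assoc, Matrix.mul_assoc, Matrix.trace_mul_comm]
      simp only [Matrix.mul_assoc]
    -- Undoing the exchange k returns Y, on which the test fails with weight at most ε; B ≥ Q makes
    -- the amplitude no worse.
    have hlast : ((1 - A' k) * ω).trace.re ≤ ε := by
      rw [hA'k, hcyc]
      have : F k * ω * F k = Y := by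
        calc F k * ω * F k = (F k * F k) * Y * (F k * F k) := by
              rw [hω]; simp only [Matrix.mul_assoc]
          _ = Y := by rw [hFF, Matrix.one_mul, Matrix.mul_one]
      rw [this]
      simp only [b]
      split_ifs
      · simpa using hε
      · refine (trace_mul_re_mono ?_ hY).trans hQY
        simpa using hBQ
    -- From C ≥ 1 - Q follows 1 - C ≤ Q: rejecting at i ≠ k fails with weight at most the false
    -- acceptance δ.
    have hprev : ∀ i ∈ Finset.range (k : ℕ), ((1 - A' i) * ω).trace.re ≤ δ := by
      intro i hi
      have hik : i < (k : ℕ) := Finset.mem_range.mp hi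
      rw [hA'lt i hik, hcyc]
      refine (trace_mul_re_mono ?_ (hconj _ _ hωpos)).trans (hQF (f i) k ?_)
      · have : Q - (1 - C) = C - (1 - Q) := by abel
        rw [this]; exact hCQ
      · rw [← hf k]; exact hfne i (by omega) k hkN hik.ne
    have hsum : ∑ i ∈ Finset.range ((k : ℕ) + 1), ((1 - A' i) * ω).trace.re ≤ N * δ + ε := by
      rw [Finset.sum_range_succ]
      refine add_le_add ((Finset.sum_le_card_nsmul _ _ _ hprev).trans ?_) hlast
      rw [Finset.card_range, nsmul_eq_mul]
      exact mul_le_mul_of_nonneg_right (by exact_mod_cast Nat.lt_succ_iff.mp hkN) hδ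
    have hfinal : (((chain A k)ᴴ * (F k * b k))ᴴ * F k * Y).trace = (chain A' (k + 1) * ω).trace := by
      rw [hchain, Matrix.conjTranspose_mul, Matrix.conjTranspose_mul,
        Matrix.conjTranspose_conjTranspose, hFh, hbh]
      calc (b k * F k * chain A k * F k * Y).trace
          = (b k * F k * chain A k * F k * Y * (F k * F k)).trace := by rw [hFF, Matrix.mul_one]
        _ = (F k * (b k * F k * chain A k * F k * Y * F k)).trace := by
            rw [← Matrix.mul_assoc, Matrix.trace_mul_comm]
        _ = _ := by rw [hω]; simp only [Matrix.mul_assoc]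
    change _ ≤ (((chain A k)ᴴ * (F k * b k))ᴴ * F k * Y).trace.re
    rw [hfinal]
    linarith

end Decoding

/-! ### Near-optimal tests. -/

section HypothesisTest

variable {X : Type*} [Fintype X] [DecidableEq X]

/-- A test which is optimal for the hypothesis testing relative entropy up to a factor of two. -/
theorem exists_test {η : ℝ} (hη0 : 0 < η) {ρ σ : Matrix X X ℂ} (hη : η ≤ ρ.trace.re)
    (hσ : σ.PosSemidef) :
    ∃ Q : Matrix X X ℂ, Q.PosSemidef ∧ (1 - Q).PosSemidef ∧ η ≤ (Q * ρ).trace.re ∧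
      (Q * σ).trace.re ≤ 2 * Real.exp (-DHyp η ρ σ) := by
  unfold DHyp DHypNormalized
  set A := {t : ℝ | ∃ Q : Matrix X X ℂ, Q.PosSemidef ∧ (1 - Q).PosSemidef ∧
    η ≤ (Q * ρ).trace.re ∧ t = η⁻¹ * (Q * σ).trace.re} with hA
  have hne : A.Nonempty :=
    ⟨_, 1, Matrix.PosSemidef.one, by simpa using Matrix.PosSemidef.zero, by simpa using hη, rfl⟩
  have hpos : 0 ≤ sInf A := by
    refine Real.sInf_nonneg ?_
    rintro t ⟨Q, hQ, -, -, rfl⟩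
    exact mul_nonneg (inv_nonneg.mpr hη0.le) (trace_mul_re_nonneg hQ hσ)
  -- Because `Real.log 0 = 0`, a vanishing infimum acts as the value 1 here. The factor 2 gives a
  -- strict inequality in either case, so no compactness argument for the minimum is needed.
  have hexp : Real.exp (-(-Real.log (sInf A) - Real.log η)) =
      η * (if sInf A = 0 then 1 else sInf A) := by
    have : -(-Real.log (sInf A) - Real.log η) = Real.log η + Real.log (sInf A) := by ring
    rw [this, Real.exp_add, Real.exp_log hη0]
    split_ifs with h
    · rw [h]; simp
    · rw [Real.exp_log (lt_of_le_of_ne hpos (Ne.symm h))]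
  have hlt : sInf A < 2 * (if sInf A = 0 then 1 else sInf A) := by
    split_ifs with h
    · rw [h]; norm_num
    · have := lt_of_le_of_ne hpos (Ne.symm h); linarith
  obtain ⟨t, ⟨Q, hQ, hQ1, hQρ, rfl⟩, ht⟩ := exists_lt_of_csInf_lt hne hlt
  refine ⟨Q, hQ, hQ1, hQρ, ?_⟩
  rw [hexp]
  rw [inv_mul_lt_iff₀ hη0] at ht
  linarith

end HypothesisTest

end ThermalErasure

namespace ThermalErasure

/-! ### Commutation with the Hamiltonians, and the number of positions. -/

section Commutation

variable {S M : Type*} [Fintype S] [DecidableEq S] [Fintype M] [DecidableEq M]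

/-- Trace the commutation relation over S: by cyclicity the H_S terms agree on both sides and
cancel. -/
theorem commute_trLeft {HS : Matrix S S ℂ} {HM : Matrix M M ℂ} {ρ : Matrix (S × M) (S × M) ℂ}
    (h : Commute ρ (totalHam HS HM)) : Commute (trLeft ρ) HM := by
  have hadd : ∀ A B : Matrix (S × M) (S × M) ℂ, trLeft (A + B) = trLeft A + trLeft B := by
    intro A B; ext m m'; simp [trLeft, Finset.sum_add_distrib]
  have := congrArg trLeft h.eq
  rw [totalHam, Matrix.mul_add, Matrix.add_mul, hadd, hadd, trLeft_kronecker_one_mul_comm,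
    trLeft_one_kronecker_mul, trLeft_mul_one_kronecker] at this
  exact add_left_cancel this

theorem commute_kronecker_totalHam {HS A : Matrix S S ℂ} {HM B : Matrix M M ℂ} (hA : Commute A HS)
    (hB : Commute B HM) : Commute (A ⊗ₖ B) (totalHam HS HM) := by
  refine Commute.add_right ?_ ?_ <;> change _ * _ = _ * _ <;>
    rw [← Matrix.mul_kronecker_mul, ← Matrix.mul_kronecker_mul]
  · rw [hA.eq, Matrix.mul_one, Matrix.one_mul]
  · rw [hB.eq, Matrix.mul_one, Matrix.one_mul]

theorem trace_kronecker_one_mul {S : Type*} [Fintype S] (Q : Matrix S S ℂ) (A : Matrix (S × M) (S × M) ℂ) :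
    ((Q ⊗ₖ (1 : Matrix M M ℂ)) * A).trace = (Q * trRight A).trace := by
  rw [← trace_trRight, trRight_kronecker_one_mul]

end Commutation

theorem posSemidef_pureState {X : Type*} [Fintype X] (ψ : X → ℂ) : (pureState ψ).PosSemidef :=
  Matrix.posSemidef_vecMulVec_self_star ψ

theorem trace_pureState {X : Type*} [Fintype X] {ψ : X → ℂ} (hψ : ∑ i, ‖ψ i‖ ^ 2 = 1) :
    (pureState ψ).trace = 1 := by
  have : (pureState ψ).trace = ((∑ i, ‖ψ i‖ ^ 2 : ℝ) : ℂ) := by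
    simp [pureState, Matrix.trace, Matrix.vecMulVec_apply, Complex.mul_conj']
  rw [this, hψ, Complex.ofReal_one]

/-- The number of positions that are decoded with error `ε`. -/
theorem exists_number_of_positions {ε : ℝ} (hε : 0 < ε) (D : ℝ) :
    ∃ N : ℕ, N * (2 * Real.exp (-D)) ≤ ε ∧
      -Real.log ((N + 1 : ℕ) : ℝ) ≤ -D + Real.log (2 / ε) := by
  have hx : 0 < ε / 2 * Real.exp D := by positivity
  -- N + 1 = ⌈(ε/2) exp D⌉. The lower bound on N + 1 gives the work gain, and N ≤ (ε/2) exp D bounds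
  -- the total false acceptance of the N wrong positions by ε.
  obtain ⟨N, hN⟩ : ∃ N, ⌈ε / 2 * Real.exp D⌉₊ = N + 1 :=
    Nat.exists_eq_succ_of_ne_zero (Nat.ceil_pos.mpr hx).ne'
  refine ⟨N, ?_, ?_⟩
  · have h1 : (N : ℝ) ≤ ε / 2 * Real.exp D := by
      have := Nat.ceil_lt_add_one hx.le
      rw [hN] at this
      push_cast at this
      linarith
    calc (N : ℝ) * (2 * Real.exp (-D)) ≤ ε / 2 * Real.exp D * (2 * Real.exp (-D)) :=
          mul_le_mul_of_nonneg_right h1 (by positivity)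
      _ = ε * (Real.exp D * Real.exp (-D)) := by ring
      _ = ε := by rw [← Real.exp_add]; simp
  · have h1 : ε / 2 * Real.exp D ≤ ((N + 1 : ℕ) : ℝ) := hN ▸ Nat.le_ceil _
    have h2 := Real.log_le_log hx h1
    rw [Real.log_mul (by positivity) (Real.exp_pos D).ne', Real.log_exp] at h2
    have h3 : Real.log (2 / ε) = -Real.log (ε / 2) := by rw [← Real.log_inv, inv_div]
    linarith

end ThermalErasure

/-! ### Assembly of the corollary. -/

theorem corollaryx {S M R : Type*}
    [Fintype S] [DecidableEq S] [Fintype M] [DecidableEq M] [Fintype R] [DecidableEq R]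
    (β : ℝ) (HS : Matrix S S ℂ) (HM : Matrix M M ℂ) (hHS : HS.IsHermitian) (hHM : HM.IsHermitian)
    -- the pure state of `SMR`
    (ψ : (S × M) × R → ℂ) (hψ : ∑ i, ‖ψ i‖ ^ 2 = 1)
    (ρSM : Matrix (S × M) (S × M) ℂ) (hρSM : ρSM = trRight (pureState ψ))
    (ρM : Matrix M M ℂ) (hρM : ρM = trLeft ρSM)
    (ρMR : Matrix (M × R) (M × R) ℂ)
    (hρMR : ρMR = trLeft ((pureState ψ).reindex (Equiv.prodAssoc S M R) (Equiv.prodAssoc S M R)))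
    (hcomm : Commute ρSM (totalHam HS HM))
    (ε : ℝ) (hε0 : 0 < ε) (hε1 : ε < 1)
    (hD : Real.log (2 / ε) ≤ DHyp (1 - ε) ρSM (gibbs β HS ⊗ₖ ρM)) :
    ∃ (d : ℕ) (τ τ' : BatteryState (Fin d))
      (Φ : Matrix ((S × M) × Fin d) ((S × M) × Fin d) ℂ →ₗ[ℂ]
        Matrix ((S × M) × Fin d) ((S × M) × Fin d) ℂ),
      IsThermalOperation β (totalHam (totalHam HS HM) (0 : Matrix (Fin d) (Fin d) ℂ)) Φ ∧
      1 - 6 * ε ≤ fidelity (applyLeft R (effectiveWorkProcess Φ τ τ') (pureState ψ))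
        ((gibbs β HS ⊗ₖ ρMR).reindex (Equiv.prodAssoc S M R).symm
          (Equiv.prodAssoc S M R).symm) ∧
      τ.charge - τ'.charge ≤
        -DHyp (1 - ε) ρSM (gibbs β HS ⊗ₖ ρM) + Real.log (2 / ε) := by
  have hψtr := trace_pureState hψ
  have : Nonempty S := by
    by_contra h
    rw [not_nonempty_iff] at h
    simp at hψ
  set γ := gibbs β HS
  set D := DHyp (1 - ε) ρSM (γ ⊗ₖ ρM)
  have hρpos : ρSM.PosSemidef := hρSM ▸ posSemidef_trRight (posSemidef_pureState ψ)
  have hρtr : ρSM.trace = 1 := by rw [hρSM, trace_trRight, hψtr]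
  have hσpos : (γ ⊗ₖ ρM).PosSemidef :=
    (posSemidef_gibbs β hHS).kronecker (hρM ▸ posSemidef_trLeft hρpos)
  obtain ⟨N, hN, hlog⟩ := exists_number_of_positions hε0 D
  obtain ⟨Q₀, hQ₀, hQ₀1, hQ₀ρ, hQ₀σ⟩ := exists_test (η := 1 - ε) (by linarith) (ρ := ρSM)
    (by rw [hρtr]; simpa using hε0.le) hσpos
  have hHh : (totalHam HS HM).IsHermitian := isHermitian_totalHam hHS hHM
  obtain ⟨Q, hQ, hQ1, hQH, hQtr⟩ := exists_pinching hHh hQ₀ hQ₀1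
  have hQρ : 1 - ε ≤ (Q * ρSM).trace.re := by rwa [hQtr ρSM hcomm]
  have hQσ : (Q * (γ ⊗ₖ ρM)).trace.re ≤ 2 * Real.exp (-D) := by
    rwa [hQtr _ (commute_kronecker_totalHam (commute_gibbs β HS) (hρM ▸ commute_trLeft hcomm))]
  obtain ⟨HB, F, hHB, hΓ, hΓtr, hFh, hFF, hFT, hF1, hF2⟩ :=
    exists_swap_bath (Fin (N + 1)) β hHS HM
  set Γ := gibbs β HB
  have hYtr : trRight (ρSM ⊗ₖ Γ) = ρSM := by rw [trRight_kronecker, hΓtr, one_smul]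
  have hQ1k : (1 - Q ⊗ₖ (1 : Matrix (Fin (N + 1) → S) (Fin (N + 1) → S) ℂ)) =
      (1 - Q) ⊗ₖ (1 : Matrix (Fin (N + 1) → S) (Fin (N + 1) → S) ℂ) := by
    rw [← Matrix.one_kronecker_one]
    ext i j
    simp only [Matrix.sub_apply, Matrix.kroneckerMap_apply, sub_mul]
  obtain ⟨L, hLL, hLT, hLF⟩ := exists_decoding_row (T := totalHam (totalHam HS HM) HB)
    (isHermitian_totalHam hHh hHB) N F hFh hFF hFT
    (Q := Q ⊗ₖ (1 : Matrix (Fin (N + 1) → S) (Fin (N + 1) → S) ℂ)) (Y := ρSM ⊗ₖ Γ)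
    (hQ.kronecker Matrix.PosSemidef.one)
    (by rw [hQ1k]; exact hQ1.kronecker Matrix.PosSemidef.one)
    (commute_kronecker_totalHam hQH (Commute.one_left HB)) (hρpos.kronecker hΓ)
    (by rw [Matrix.trace_kronecker, hρtr, hΓtr, one_mul])
    (ε := ε) (δ := 2 * Real.exp (-D)) (by positivity) hε0.le
    (by
      rw [hQ1k, trace_kronecker_one_mul, hYtr, Matrix.sub_mul, Matrix.one_mul, Matrix.trace_sub,
        hρtr, Complex.sub_re, Complex.one_re]
      linarith)
    (fun i j hij => by rwa [trace_kronecker_one_mul, hF2 i j _ hij, ← hρM])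
  obtain ⟨τ, τ', Φ, hΦ, hwork, hcharge⟩ :=
    exists_thermalOperation_of_row β hHh hHB (Nat.succ_pos N) L hLL hLT
  refine ⟨N + 1 + 1, τ, τ', Φ, hΦ, ?_, hcharge.trans_le hlog⟩
  have hNpos : (0 : ℝ) < ((N + 1 : ℕ) : ℝ) := by positivity
  -- The decoding process L is compared with the exchanges F, whose averaged output is exactly the
  -- target state.
  refine le_trans ?_ (overlap_le_fidelity (c := ((N + 1 : ℕ) : ℝ)⁻¹) (by positivity) ψ hΓ L F
    (fun i j => ?_) (fun i j => ?_))
  · rw [← hρSM]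
    have h := Finset.card_nsmul_le_sum Finset.univ _ _ fun k _ => hLF k
    rw [Finset.card_univ, Fintype.card_fin, nsmul_eq_mul] at h
    rw [inv_mul_eq_div, le_div_iff₀ hNpos]
    refine le_trans ?_ h
    rw [mul_comm]
    -- N δ ≤ ε makes each overlap at least 1 - 4ε, which exceeds 1 - 6ε.
    exact mul_le_mul_of_nonneg_left (by linarith) hNpos.le
  · exact congrFun (congrFun (hwork (stateBlock ψ i.2 j.2)) i.1) j.1
  · obtain ⟨⟨s, m⟩, r⟩ := i
    obtain ⟨⟨s', m'⟩, r'⟩ := j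
    simp only [bathProcess, hFh, hF1, Finset.sum_const, Finset.card_univ, Fintype.card_fin]
    rw [← Nat.cast_smul_eq_nsmul ℂ, smul_smul, Complex.ofReal_inv, Complex.ofReal_natCast,
      inv_mul_cancel₀ (by exact_mod_cast hNpos.ne'), one_smul, hρMR]
    rfl
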